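/- Theorem 3.1. Let $H$ be a complex Hilbert space, and call a family $(T_t)_{t\ge 0}$ of $\sigma$-weakly continuous, completely positive linear maps on $\mathcal B(H)$ a quantum Markov semigroup (QMS) if $T_0=1$, $T_{t+s}=T_tT_s$, $T_t(1)=1$ for all $t,s\ge 0$, and $t\mapsto T_t(A)$ is $\sigma$-weakly continuous for every $A\in\mathcal B(H)$; it is called uniformly continuous if $t\mapsto T_t$ is norm continuous. The generator of a QMS is $L(A)=\lim_{t\to 0^+}\frac1t(T_tA-A)$ ($\sigma$-weak limit), with domain $D(L)$ the set of all $A\in\mathcal B(H)$ for which this limit exists. Let $L$ be the generator of a QMS on $\mathcal B(H)$. Then for every $\epsilon>0$ the map $1-\epsilon L:D(L)\to\mathcal B(H)$ is bijective, and $L_\epsilon=L(1-\epsilon L)^{-1}$ is a bounded linear map on $\mathcal B(H)$ that is the generator (with domain all of $\mathcal B(H)$) of a uniformly continuous QMS on $\mathcal B(H)$. Moreover $$L(A)=\lim_{\epsilon\to 0^+}L_\epsilon(A)\quad\text{$\sigma$-weakly, for all }A\in D(L).$$ Furthermore there exist a family $(\phi_\epsilon)_{\epsilon>0}$ of normal (that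 is, $\sigma$-weakly continuous) completely positive linear maps on $\mathcal B(H)$ and a family $(G_\epsilon)_{\epsilon>0}$ of bounded operators on $H$ such that $$L_\epsilon(A)=\phi_\epsilon(A)+G_\epsilon A+AG_\epsilon^*\quad\text{for all }A\in\mathcal B(H)\text{ and }\epsilon>0,$$ and hence $L(A)=\lim_{\epsilon\to0^+}\bigl(\phi_\epsilon(A)+G_\epsilon A+AG_\epsilon^*\bigr)$ $\sigma$-weakly for all $A\in D(L)$. -/

import Mathlib

open Filter Topology
open scoped NNReal CStarAlgebra

noncomputable section

section SigmaWeak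

variable {H : Type*} [NormedAddCommGroup H] [InnerProductSpace ℂ H]

/-- The σ-weakly continuous functional `A ↦ ∑ₙ ⟨xₙ, A yₙ⟩` on `B(H)` given by two square-summable
sequences of vectors, that is, `A ↦ tr (A K)` for the trace class operator `K = ∑ₙ |yₙ⟩⟨xₙ|`.
Every trace class operator is of this form. -/
def predualFunctional (x y : lp (fun _ : ℕ => H) 2) (A : H →L[ℂ] H) : ℂ :=
  ∑' n, inner ℂ (x n) (A (y n))

variable (H) in
/-- The σ-weak topology of `B(H)`: the coarsest topology that makes all functionals
`A ↦ ∑ₙ ⟨xₙ, A yₙ⟩`, with `(xₙ)` and `(yₙ)` square-summable, continuous. -/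
@[reducible] def sigmaWeak : TopologicalSpace (H →L[ℂ] H) :=
  ⨅ p : lp (fun _ : ℕ => H) 2 × lp (fun _ : ℕ => H) 2,
    TopologicalSpace.induced (predualFunctional p.1 p.2) inferInstance

/-- Convergence `f → A` along the filter `l` in the σ-weak topology. -/
def SigmaWeakTendsto {α : Type*} (f : α → H →L[ℂ] H) (l : Filter α) (A : H →L[ℂ] H) : Prop :=
  Tendsto f l (@nhds _ (sigmaWeak H) A)

/-- A map on `B(H)` is normal if it is σ-weakly continuous. -/
def IsNormalMap (φ : (H →L[ℂ] H) →L[ℂ] (H →L[ℂ] H)) : Prop :=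
  Continuous[sigmaWeak H, sigmaWeak H] φ

variable [CompleteSpace H] in
/-- `φ` is completely positive: for every `n`, applying `φ` to the entries of `n × n` matrices over
`B(H)` maps positive elements of the C⋆-algebra of `n × n` matrices over `B(H)` to positive ones. -/
def IsCompletelyPositive (φ : (H →L[ℂ] H) →L[ℂ] (H →L[ℂ] H)) : Prop :=
  ∀ (n : ℕ) (M : CStarMatrix (Fin n) (Fin n) (H →L[ℂ] H)), 0 ≤ M → 0 ≤ M.map φ

theorem predualFunctional_summable (x y : lp (fun _ : ℕ => H) 2) (A : H →L[ℂ] H) :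
    Summable fun n => inner ℂ (x n) (A (y n)) := by
  have hx : Summable fun n => ‖x n‖ ^ 2 := by
    have := (lp.memℓp x).summable (by norm_num)
    simpa using this
  have hy : Summable fun n => ‖y n‖ ^ 2 := by
    have := (lp.memℓp y).summable (by norm_num)
    simpa using this
  refine Summable.of_norm_bounded ((hx.add hy).mul_left ‖A‖) fun n => ?_
  calc ‖inner ℂ (x n) (A (y n))‖ ≤ ‖x n‖ * (‖A‖ * ‖y n‖) :=
        (norm_inner_le_norm _ _).trans (by gcongr; exact A.le_opNorm _)
    _ ≤ ‖A‖ * (‖x n‖ ^ 2 + ‖y n‖ ^ 2) := by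
        nlinarith [norm_nonneg A, mul_nonneg (norm_nonneg A) (sq_nonneg (‖x n‖ - ‖y n‖)),
          mul_nonneg (norm_nonneg A) (add_nonneg (sq_nonneg ‖x n‖) (sq_nonneg ‖y n‖))]

theorem predualFunctional_add (x y : lp (fun _ : ℕ => H) 2) (A B : H →L[ℂ] H) :
    predualFunctional x y (A + B) = predualFunctional x y A + predualFunctional x y B := by
  simp only [predualFunctional, add_apply, inner_add_right]
  exact (predualFunctional_summable x y A).tsum_add (predualFunctional_summable x y B)

theorem predualFunctional_smul (x y : lp (fun _ : ℕ => H) 2) (c : ℂ) (A : H →L[ℂ] H) :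
    predualFunctional x y (c • A) = c * predualFunctional x y A := by
  simp only [predualFunctional, smul_apply, inner_smul_right]
  exact tsum_mul_left

theorem sigmaWeakTendsto_iff {α : Type*} {f : α → H →L[ℂ] H} {l : Filter α} {A : H →L[ℂ] H} :
    SigmaWeakTendsto f l A ↔ ∀ x y : lp (fun _ : ℕ => H) 2,
      Tendsto (fun a => predualFunctional x y (f a)) l (𝓝 (predualFunctional x y A)) := by
  unfold SigmaWeakTendsto sigmaWeak
  rw [nhds_iInf, tendsto_iInf, Prod.forall]
  refine forall_congr' fun x => forall_congr' fun y => ?_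
  rw [nhds_induced, tendsto_comap_iff]
  rfl

theorem SigmaWeakTendsto.add {α : Type*} {f g : α → H →L[ℂ] H} {l : Filter α} {A B : H →L[ℂ] H}
    (hf : SigmaWeakTendsto f l A) (hg : SigmaWeakTendsto g l B) :
    SigmaWeakTendsto (fun a => f a + g a) l (A + B) := by
  rw [sigmaWeakTendsto_iff] at *
  intro x y
  simpa only [predualFunctional_add] using (hf x y).add (hg x y)

theorem SigmaWeakTendsto.smul {α : Type*} {f : α → H →L[ℂ] H} {l : Filter α} {A : H →L[ℂ] H}
    (c : ℂ) (hf : SigmaWeakTendsto f l A) : SigmaWeakTendsto (fun a => c • f a) l (c • A) := by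
  rw [sigmaWeakTendsto_iff] at *
  intro x y
  simpa only [predualFunctional_smul] using (hf x y).const_mul c

theorem SigmaWeakTendsto.unique {α : Type*} {f : α → H →L[ℂ] H} {l : Filter α} [l.NeBot]
    {A B : H →L[ℂ] H} (hA : SigmaWeakTendsto f l A) (hB : SigmaWeakTendsto f l B) : A = B := by
  rw [sigmaWeakTendsto_iff] at hA hB
  refine ContinuousLinearMap.ext fun v => ext_inner_left ℂ fun u => ?_
  have h := tendsto_nhds_unique (hA (lp.single 2 0 u) (lp.single 2 0 v))
    (hB (lp.single 2 0 u) (lp.single 2 0 v))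
  have key : ∀ C : H →L[ℂ] H,
      predualFunctional (lp.single 2 0 u) (lp.single 2 0 v) C = inner ℂ u (C v) := by
    intro C
    rw [predualFunctional, tsum_eq_single 0]
    · simp
    · intro n hn
      simp [hn]
  rwa [key, key] at h

end SigmaWeak

/-- A quantum dynamical semigroup on `B(H)`. (Completely positive maps are automatically bounded,
so that bundling `T t` as a bounded operator is no restriction.) -/
structure QuantumDynamicalSemigroup (H : Type*) [NormedAddCommGroup H] [InnerProductSpace ℂ H]
    [CompleteSpace H] where
  /-- The maps `T t`, for `t ≥ 0`. -/
  T : ℝ≥0 → (H →L[ℂ] H) →L[ℂ] (H →L[ℂ] H)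
  normal : ∀ t, IsNormalMap (T t)
  completelyPositive : ∀ t, IsCompletelyPositive (T t)
  map_zero : ∀ A, T 0 A = A
  map_add : ∀ t s A, T (t + s) A = T t (T s A)
  sigmaWeak_continuous : ∀ A, Continuous[inferInstance, sigmaWeak H] fun t => T t A

namespace QuantumDynamicalSemigroup

variable {H : Type*} [NormedAddCommGroup H] [InnerProductSpace ℂ H] [CompleteSpace H]
  (S : QuantumDynamicalSemigroup H)

/-- The semigroup is a quantum Markov semigroup (QMS): every `T t` preserves the identity. -/
def IsMarkov : Prop := ∀ t, S.T t 1 = 1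

/-- The semigroup is uniformly continuous: `t ↦ T t` is continuous in the operator norm. -/
def IsUniformlyContinuous : Prop := Continuous S.T

/-- `(1/t) (T t A - A)` converges σ-weakly to `B` as `t → 0⁺`. -/
def GeneratesAt (A B : H →L[ℂ] H) : Prop :=
  SigmaWeakTendsto (fun t : ℝ≥0 => ((t : ℝ) : ℂ)⁻¹ • (S.T t A - A)) (𝓝[>] 0) B

variable {S} in
theorem GeneratesAt.add {A A' B B' : H →L[ℂ] H} (h : S.GeneratesAt A B)
    (h' : S.GeneratesAt A' B') : S.GeneratesAt (A + A') (B + B') := by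
  have := SigmaWeakTendsto.add h h'
  refine this.congr fun t => ?_
  rw [_root_.map_add, ← smul_add]
  congr 1
  abel

variable {S} in
theorem GeneratesAt.smul {A B : H →L[ℂ] H} (c : ℂ) (h : S.GeneratesAt A B) :
    S.GeneratesAt (c • A) (c • B) := by
  have := SigmaWeakTendsto.smul c h
  refine this.congr fun t => ?_
  rw [_root_.map_smul, ← smul_sub, smul_comm]

theorem generatesAt_zero : S.GeneratesAt 0 0 := by
  have h : SigmaWeakTendsto (fun _ : ℝ≥0 => (0 : H →L[ℂ] H)) (𝓝[>] 0) 0 :=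
    sigmaWeakTendsto_iff.2 fun _ _ => tendsto_const_nhds
  refine h.congr fun t => ?_
  simp

variable {S} in
theorem GeneratesAt.unique {A B C : H →L[ℂ] H} (h : S.GeneratesAt A B) (h' : S.GeneratesAt A C) :
    B = C :=
  SigmaWeakTendsto.unique h h'

/-- The infinitesimal generator `L` of the semigroup: its domain consists of the `A` for which
`(1/t) (T t A - A)` converges σ-weakly as `t → 0⁺`, and `L A` is the limit. -/
def generator : (H →L[ℂ] H) →ₗ.[ℂ] (H →L[ℂ] H) where
  domain :=
    { carrier := {A | ∃ B, S.GeneratesAt A B}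
      add_mem' := fun ⟨_, h⟩ ⟨_, h'⟩ => ⟨_, h.add h'⟩
      zero_mem' := ⟨0, S.generatesAt_zero⟩
      smul_mem' := fun c _ ⟨_, h⟩ => ⟨_, h.smul c⟩ }
  toFun :=
    { toFun := fun A => A.2.choose
      map_add' := fun A A' =>
        (A + A').2.choose_spec.unique (A.2.choose_spec.add A'.2.choose_spec)
      map_smul' := fun c A => (c • A).2.choose_spec.unique (A.2.choose_spec.smul c) }

theorem generator_spec (A : S.generator.domain) : S.GeneratesAt A (S.generator A) :=
  A.2.choose_spec

end QuantumDynamicalSemigroup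

/-- `M = L (1 - ε L)⁻¹`: the map `1 - ε L : D(L) → E` is a bijection, and composing its inverse
with `L` gives `M`. -/
def IsResolventComposite {E : Type*} [NormedAddCommGroup E] [NormedSpace ℂ E] (L : E →ₗ.[ℂ] E)
    (ε : ℝ) (M : E →L[ℂ] E) : Prop :=
  ∃ h : Function.Bijective (L.domain.subtype - (ε : ℂ) • L.toFun),
    ∀ A : E, M A = L ((LinearEquiv.ofBijective (L.domain.subtype - (ε : ℂ) • L.toFun) h).symm A)

end

open InnerProductSpace ComplexOrder MeasureTheory

noncomputable section

/-! ### Diagonal σ-weak functionals. -/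

section SigmaWeakFunctionals

variable {H : Type*} [NormedAddCommGroup H] [InnerProductSpace ℂ H]

/-! This is the Yosida approximation. Let `R_ε = ∫ e⁻ˢ T (ε s) ds`, the mean of the semigroup under
an exponential law. A mean of unital, normal, completely positive maps is again one. Shifting the
integral shows that `R_ε` maps into `D(L)` and is a right inverse of `1 - ε L`
(`tendsto_integral_expLaw_add`). If `ε L A = A`, then `ω (T t A)` grows like `exp (t/ε)` for each
diagonal functional `ω`, while `T t A` is bounded, so `A = 0` (`IsMarkov.eq_zero_of_generatesAt`).
Hence `R_ε = (1 - ε L)⁻¹` and `L_ε = ε⁻¹ (R_ε - 1)`.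

The rest follows from this formula. First, `exp (t L_ε) = exp (-t/ε) exp ((t/ε) R_ε)` is a positive
scalar times a power series in `R_ε` with nonnegative coefficients, hence completely positive; it
fixes `1` because `L_ε 1 = 0`. On `D(L)`, `L_ε A = R_ε (L A)`, which tends to `L A` since the
exponential laws concentrate at `0`. Finally `φ_ε = ε⁻¹ R_ε` and `G_ε = -(2ε)⁻¹` give the
decomposition.

The analytic difficulty is normality, of `R_ε` and of norm limits. It rests on a criterion: a
positive functional `ψ` is σ-weakly continuous if `ψ (P_F) → ψ 1` along the finite-rank projections
of a Hilbert basis (`IsTight.exists_predualFunctional`). For means this follows from Dini's theorem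
and tightness of the law. Complete positivity passes to means and limits because it is tested by
quadratic forms (`CStarMatrix.nonneg_iff_form_nonneg`). -/

omit [InnerProductSpace ℂ H] in
theorem lp_two_summable_norm_sq (x : lp (fun _ : ℕ => H) 2) : Summable fun n => ‖x n‖ ^ 2 := by
  simpa using (lp.memℓp x).summable (by norm_num)

omit [InnerProductSpace ℂ H] in
theorem lp_two_summable_norm_mul_norm (x y : lp (fun _ : ℕ => H) 2) :
    Summable fun n => ‖x n‖ * ‖y n‖ := by
  refine Summable.of_nonneg_of_le (fun n => by positivity) (fun n => ?_)
    ((lp_two_summable_norm_sq x).add (lp_two_summable_norm_sq y))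
  nlinarith [sq_nonneg (‖x n‖ - ‖y n‖), sq_nonneg (‖x n‖), sq_nonneg (‖y n‖)]

theorem norm_inner_apply_le (u v : H) (A : H →L[ℂ] H) :
    ‖inner ℂ u (A v)‖ ≤ ‖u‖ * ‖v‖ * ‖A‖ :=
  calc ‖inner ℂ u (A v)‖ ≤ ‖u‖ * (‖A‖ * ‖v‖) :=
        (norm_inner_le_norm _ _).trans (by gcongr; exact A.le_opNorm _)
    _ = ‖u‖ * ‖v‖ * ‖A‖ := by ring

theorem norm_predualFunctional_le (x y : lp (fun _ : ℕ => H) 2) (A : H →L[ℂ] H) :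
    ‖predualFunctional x y A‖ ≤ (∑' n, ‖x n‖ * ‖y n‖) * ‖A‖ := by
  rw [← tsum_mul_right]
  exact tsum_of_norm_bounded ((lp_two_summable_norm_mul_norm x y).mul_right _).hasSum
    fun n => norm_inner_apply_le _ _ _

/-- `predualFunctional x y` as a bounded functional. -/
def predualCLM (x y : lp (fun _ : ℕ => H) 2) : (H →L[ℂ] H) →L[ℂ] ℂ :=
  LinearMap.mkContinuous
    { toFun := predualFunctional x y
      map_add' := predualFunctional_add x y
      map_smul' := predualFunctional_smul x y }
    (∑' n, ‖x n‖ * ‖y n‖) (norm_predualFunctional_le x y)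

@[simp]
theorem predualCLM_apply (x y : lp (fun _ : ℕ => H) 2) (A : H →L[ℂ] H) :
    predualCLM x y A = predualFunctional x y A := rfl

theorem predualFunctional_single (u v : H) (A : H →L[ℂ] H) :
    predualFunctional (lp.single 2 0 u) (lp.single 2 0 v) A = inner ℂ u (A v) := by
  rw [predualFunctional, tsum_eq_single 0]
  · simp
  · intro n hn
    simp [hn]

/-- Termwise polarization. It reduces σ-weak questions to the diagonal functionals, which are
positive. -/
theorem predualFunctional_polarization (x y : lp (fun _ : ℕ => H) 2) (A : H →L[ℂ] H) :
    predualFunctional x y A = (predualFunctional (x + y) (x + y) A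
      - predualFunctional (x - y) (x - y) A
      - Complex.I * predualFunctional (x + Complex.I • y) (x + Complex.I • y) A
      + Complex.I * predualFunctional (x - Complex.I • y) (x - Complex.I • y) A) / 4 := by
  have h := fun u v : lp (fun _ : ℕ => H) 2 => (predualFunctional_summable u v A)
  simp only [predualFunctional]
  rw [← tsum_mul_left, ← tsum_mul_left, ← (h _ _).tsum_sub (h _ _),
    ← ((h _ _).sub (h _ _)).tsum_sub ((h _ _).mul_left _),
    ← (((h _ _).sub (h _ _)).sub ((h _ _).mul_left _)).tsum_add ((h _ _).mul_left _),
    ← tsum_div_const]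
  congr 1 with n
  simp only [lp.coeFn_add, lp.coeFn_sub, lp.coeFn_smul, Pi.add_apply, Pi.sub_apply, Pi.smul_apply,
    map_add, map_sub, map_smul, inner_add_left, inner_add_right, inner_sub_left, inner_sub_right,
    inner_smul_left, inner_smul_right, Complex.conj_I]
  linear_combination (inner ℂ (x n) (A (y n)) / 2 - inner ℂ (y n) (A (x n)) / 2) * Complex.I_sq

theorem predualFunctional_continuous (x y : lp (fun _ : ℕ => H) 2) :
    Continuous[sigmaWeak H, inferInstance] (predualFunctional x y) :=
  continuous_iInf_dom (i := (x, y)) continuous_induced_dom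

theorem continuous_sigmaWeak_iff {α : Type*} [TopologicalSpace α] {f : α → H →L[ℂ] H} :
    Continuous[inferInstance, sigmaWeak H] f ↔
      ∀ x y : lp (fun _ : ℕ => H) 2, Continuous fun a => predualFunctional x y (f a) := by
  unfold sigmaWeak
  rw [continuous_iInf_rng, Prod.forall]
  refine forall_congr' fun x => forall_congr' fun y => ?_
  rw [continuous_induced_rng]
  rfl

theorem sigmaWeakTendsto_iff_diag {α : Type*} {f : α → H →L[ℂ] H} {l : Filter α} {A : H →L[ℂ] H} :
    SigmaWeakTendsto f l A ↔ ∀ x : lp (fun _ : ℕ => H) 2,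
      Tendsto (fun a => predualFunctional x x (f a)) l (𝓝 (predualFunctional x x A)) := by
  rw [sigmaWeakTendsto_iff]
  refine ⟨fun h x => h x x, fun h x y => ?_⟩
  simp_rw [predualFunctional_polarization x y]
  exact ((((h _).sub (h _)).sub ((h _).const_mul _)).add ((h _).const_mul _)).div_const _

theorem sigmaWeakTendsto_of_tendsto {α : Type*} {f : α → H →L[ℂ] H} {l : Filter α} {A : H →L[ℂ] H}
    (h : Tendsto f l (𝓝 A)) : SigmaWeakTendsto f l A :=
  sigmaWeakTendsto_iff.2 fun x y => ((predualCLM x y).continuous.tendsto A).comp h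

theorem ext_predualFunctional {A B : H →L[ℂ] H}
    (h : ∀ x : lp (fun _ : ℕ => H) 2, predualFunctional x x A = predualFunctional x x B) :
    A = B := by
  refine ContinuousLinearMap.ext fun v => ext_inner_left ℂ fun u => ?_
  rw [← predualFunctional_single, ← predualFunctional_single, predualFunctional_polarization,
    predualFunctional_polarization _ _ B]
  simp only [h]

/-- A bounded map is normal as soon as it pulls diagonal functionals back to diagonal ones. -/
theorem isNormalMap_of_diag {φ : (H →L[ℂ] H) →L[ℂ] (H →L[ℂ] H)}
    (h : ∀ x : lp (fun _ : ℕ => H) 2, ∃ z : lp (fun _ : ℕ => H) 2,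
      ∀ A, predualFunctional x x (φ A) = predualFunctional z z A) : IsNormalMap φ := by
  let := sigmaWeak H
  have hd : ∀ x : lp (fun _ : ℕ => H) 2, Continuous fun A => predualFunctional x x (φ A) := by
    intro x
    obtain ⟨z, hz⟩ := h x
    simp_rw [hz]
    exact predualFunctional_continuous z z
  refine continuous_sigmaWeak_iff.2 fun x y => ?_
  simp_rw [predualFunctional_polarization x y]
  exact ((((hd _).sub (hd _)).sub (continuous_const.mul (hd _))).add
    (continuous_const.mul (hd _))).div_const _

/-- The functional given by a square-summable family over any index set is given by a sequence. -/
theorem exists_predualFunctional_eq_tsum {ι : Type*} {x : ι → H}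
    (hx : Summable fun i => ‖x i‖ ^ 2) :
    ∃ z : lp (fun _ : ℕ => H) 2, ∀ A, predualFunctional z z A = ∑' i, inner ℂ (x i) (A (x i)) := by
  classical
  -- A summable family has countable support, so the nonzero vectors can be placed injectively in
  -- `ℕ` and padded with zeros.
  set s : Set ι := Function.support fun i => ‖x i‖ ^ 2 with hs
  have hc : s.Countable := hx.countable_support
  have := hc.to_subtype
  obtain ⟨e, he⟩ := exists_injective_nat s
  set z : ℕ → H := Function.extend e (fun i : s => x i) 0 with hz
  have hzn : (fun n => ‖z n‖ ^ 2) = Function.extend e (fun i : s => ‖x i‖ ^ 2) 0 := by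
    ext n
    by_cases hn : ∃ i, e i = n
    · obtain ⟨i, rfl⟩ := hn
      rw [hz, he.extend_apply, he.extend_apply]
    · rw [hz, Function.extend_apply' _ _ _ hn, Function.extend_apply' _ _ _ hn]
      simp
  have hmem : Memℓp z 2 := by
    refine memℓp_gen ?_
    have : Summable fun n => ‖z n‖ ^ 2 := by
      rw [hzn]
      exact (summable_extend_zero he).2 (hx.subtype s)
    simpa using this
  refine ⟨⟨z, hmem⟩, fun A => ?_⟩
  have hzA : (fun n => inner ℂ (z n) (A (z n)))
      = Function.extend e (fun i : s => inner ℂ (x i) (A (x i))) 0 := by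
    ext n
    by_cases hn : ∃ i, e i = n
    · obtain ⟨i, rfl⟩ := hn
      rw [hz, he.extend_apply, he.extend_apply]
    · rw [hz, Function.extend_apply' _ _ _ hn, Function.extend_apply' _ _ _ hn]
      simp
  change ∑' n, inner ℂ (z n) (A (z n)) = _
  rw [hzA, tsum_extend_zero he]
  refine tsum_subtype_eq_of_support_subset (f := fun i => inner ℂ (x i) (A (x i))) fun i hi => ?_
  rw [hs, Function.mem_support]
  rintro h0
  exact hi (by simp [norm_eq_zero.1 (pow_eq_zero_iff two_ne_zero |>.1 h0)])

theorem predualFunctional_nonneg (x : lp (fun _ : ℕ => H) 2) {A : H →L[ℂ] H} (hA : 0 ≤ A) :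
    0 ≤ predualFunctional x x A :=
  tsum_nonneg fun _ => ((ContinuousLinearMap.nonneg_iff_isPositive A).1 hA).inner_nonneg_right _

end SigmaWeakFunctionals

/-! ### Normality tested on finite-rank projections. -/

section Tight

variable {H : Type*} [NormedAddCommGroup H] [InnerProductSpace ℂ H] {ι : Type*}

/-- The projection onto the span of finitely many vectors of a Hilbert basis. -/
def HilbertBasis.finProj (b : HilbertBasis ι ℂ H) (F : Finset ι) : H →L[ℂ] H :=
  ∑ i ∈ F, rankOne ℂ (b i) (b i)

theorem HilbertBasis.finProj_tendsto (b : HilbertBasis ι ℂ H) (v : H) :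
    Tendsto (fun F => b.finProj F v) atTop (𝓝 v) := by
  have h := b.hasSum_repr v
  simpa [HasSum, HilbertBasis.finProj, b.repr_apply_apply] using h

theorem HilbertBasis.finProj_mul_self (b : HilbertBasis ι ℂ H) (F : Finset ι) :
    b.finProj F * b.finProj F = b.finProj F := by
  classical
  have h := orthonormal_iff_ite.1 b.orthonormal
  simp only [HilbertBasis.finProj, Finset.sum_mul, Finset.mul_sum]
  refine Finset.sum_congr rfl fun i hi => ?_
  rw [Finset.sum_eq_single i]
  · rw [ContinuousLinearMap.mul_def, rankOne_comp_rankOne, h]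
    simp
  · intro j _ hj
    rw [ContinuousLinearMap.mul_def, rankOne_comp_rankOne, h, if_neg hj]
    simp
  · exact fun h => absurd hi h

theorem HilbertBasis.finProj_mono (b : HilbertBasis ι ℂ H) : Monotone b.finProj := by
  intro F G hFG
  rw [ContinuousLinearMap.le_def]
  classical
  have : b.finProj G - b.finProj F = ∑ i ∈ G \ F, rankOne ℂ (b i) (b i) := by
    rw [HilbertBasis.finProj, HilbertBasis.finProj, ← Finset.sum_sdiff hFG, add_sub_cancel_right]
  rw [this]
  exact ContinuousLinearMap.isPositive_sum _ fun _ _ => isPositive_rankOne_self _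

variable [CompleteSpace H]

theorem HilbertBasis.star_finProj (b : HilbertBasis ι ℂ H) (F : Finset ι) :
    star (b.finProj F) = b.finProj F :=
  (ContinuousLinearMap.isPositive_sum _ fun _ _ => isPositive_rankOne_self _).isSelfAdjoint

theorem HilbertBasis.one_sub_finProj_mul_self (b : HilbertBasis ι ℂ H) (F : Finset ι) :
    star (1 - b.finProj F) * (1 - b.finProj F) = 1 - b.finProj F := by
  rw [star_sub, star_one, b.star_finProj, mul_sub, sub_mul, sub_mul, b.finProj_mul_self]
  simp

theorem HilbertBasis.finProj_le_one (b : HilbertBasis ι ℂ H) (F : Finset ι) : b.finProj F ≤ 1 := by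
  rw [← sub_nonneg, ← b.one_sub_finProj_mul_self]
  exact star_mul_self_nonneg _

omit [CompleteSpace H] in
theorem HilbertBasis.finProj_nonneg (b : HilbertBasis ι ℂ H) (F : Finset ι) : 0 ≤ b.finProj F := by
  simpa [HilbertBasis.finProj] using b.finProj_mono (Finset.empty_subset F)

theorem HilbertBasis.norm_finProj_le (b : HilbertBasis ι ℂ H) (F : Finset ι) : ‖b.finProj F‖ ≤ 1 :=
  CStarAlgebra.norm_le_one_iff_of_nonneg _ (b.finProj_nonneg F) |>.2 (b.finProj_le_one F)

/-- Strong convergence together with the norm bound `1`; the dominated convergence is over the index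
of the series, so it works along the net of finite sets. -/
theorem HilbertBasis.sigmaWeakTendsto_finProj (b : HilbertBasis ι ℂ H) :
    SigmaWeakTendsto b.finProj atTop (1 : H →L[ℂ] H) := by
  refine sigmaWeakTendsto_iff.2 fun x y => ?_
  refine tendsto_tsum_of_dominated_convergence (lp_two_summable_norm_mul_norm x y)
    (fun n => ?_) (Eventually.of_forall fun F n => ?_)
  · exact ((continuous_const.inner continuous_id).tendsto _).comp (b.finProj_tendsto (y n))
  · refine (norm_inner_apply_le _ _ _).trans ?_
    exact mul_le_of_le_one_right (by positivity) (b.norm_finProj_le F)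

/-- A bounded functional on `B(H)` is tight with respect to a Hilbert basis if it is determined at
`1` by the finite rank projections of the basis. -/
def IsTight (b : HilbertBasis ι ℂ H) (ψ : (H →L[ℂ] H) →L[ℂ] ℂ) : Prop :=
  Tendsto (fun F => ψ (b.finProj F)) atTop (𝓝 (ψ 1))

theorem isTight_predualCLM (b : HilbertBasis ι ℂ H) (x y : lp (fun _ : ℕ => H) 2) :
    IsTight b (predualCLM x y) :=
  sigmaWeakTendsto_iff.1 b.sigmaWeakTendsto_finProj x y

/-- Cauchy–Schwarz for the GNS semi-inner product of `ψ`. -/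
theorem norm_apply_star_mul_le {ψ : (H →L[ℂ] H) →L[ℂ] ℂ} (hψ : ∀ A, 0 ≤ A → 0 ≤ ψ A)
    (A B : H →L[ℂ] H) :
    ‖ψ (star A * B)‖ ≤ √‖ψ (star A * A)‖ * √‖ψ (star B * B)‖ := by
  set f : (H →L[ℂ] H) →ₚ[ℂ] ℂ := PositiveLinearMap.mk₀ (ψ : (H →L[ℂ] H) →ₗ[ℂ] ℂ) hψ
  have h := norm_inner_le_norm (𝕜 := ℂ) (f.toPreGNS A) (f.toPreGNS B)
  refine h.trans_eq ?_
  rw [f.preGNS_norm_def, f.preGNS_norm_def]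
  congr 2
  · exact congrArg Complex.re (Complex.norm_of_nonneg' (hψ _ (star_mul_self_nonneg A))).symm
  · exact congrArg Complex.re (Complex.norm_of_nonneg' (hψ _ (star_mul_self_nonneg B))).symm

/-- By Cauchy–Schwarz, cutting `A` down to `P A P` costs at most a multiple of `√‖ψ (1 - P)‖`, which
tightness sends to `0`. Thus a positive tight functional is determined by its values on finite-rank
operators. -/
theorem IsTight.tendsto_compress {b : HilbertBasis ι ℂ H} {ψ : (H →L[ℂ] H) →L[ℂ] ℂ}
    (hψ : ∀ A, 0 ≤ A → 0 ≤ ψ A) (ht : IsTight b ψ) (A : H →L[ℂ] H) :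
    Tendsto (fun F => ψ (b.finProj F * A * b.finProj F)) atTop (𝓝 (ψ A)) := by
  have hQ : Tendsto (fun F => √‖ψ (1 - b.finProj F)‖) atTop (𝓝 0) := by
    have h : Tendsto (fun F => ψ (1 - b.finProj F)) atTop (𝓝 (ψ 1 - ψ 1)) := by
      simpa only [map_sub] using ht.const_sub (ψ 1)
    simpa using h.norm.sqrt
  rw [tendsto_iff_norm_sub_tendsto_zero]
  have hbound : ∀ F, ‖ψ (b.finProj F * A * b.finProj F) - ψ A‖ ≤
      √‖ψ (1 - b.finProj F)‖ * √‖ψ (star A * A)‖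
        + √(‖ψ‖ * ‖A‖ ^ 2) * √‖ψ (1 - b.finProj F)‖ := by
    intro F
    set P := b.finProj F with hP
    have hPs : star P = P := b.star_finProj F
    have h1 := norm_apply_star_mul_le hψ (1 - P) A
    have h2 := norm_apply_star_mul_le hψ (star (P * A)) (1 - P)
    rw [b.one_sub_finProj_mul_self, ← hP] at h1 h2
    rw [star_star] at h2
    -- The two error terms each contain one factor `1 - P`, on the left or on the right, as
    -- Cauchy–Schwarz requires.
    have hdec : ψ (P * A * P) - ψ A = -(ψ (star (1 - P) * A) + ψ (P * A * (1 - P))) := by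
      rw [← map_add, ← map_sub, ← map_neg, star_sub, star_one, hPs]
      congr 1
      noncomm_ring
    rw [hdec, norm_neg]
    refine (norm_add_le _ _).trans (add_le_add h1 (h2.trans ?_))
    gcongr
    refine (ψ.le_opNorm _).trans ?_
    gcongr
    calc ‖P * A * star (P * A)‖ ≤ ‖P * A‖ * ‖P * A‖ := by
          simpa only [norm_star] using norm_mul_le (P * A) (star (P * A))
      _ ≤ ‖A‖ ^ 2 := by
          have : ‖P * A‖ ≤ ‖A‖ := (norm_mul_le _ _).trans
            (mul_le_of_le_one_left (norm_nonneg _) (b.norm_finProj_le F))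
          rw [sq]
          gcongr
  refine squeeze_zero (fun _ => norm_nonneg _) hbound ?_
  simpa using (hQ.mul_const _).add (hQ.const_mul _)

omit [CompleteSpace H] in
-- `P A P` is a finite linear combination of rank-one operators.
theorem apply_compress_eq {b : HilbertBasis ι ℂ H} {ψ ψ' : (H →L[ℂ] H) →L[ℂ] ℂ}
    (h : ∀ u v, ψ (rankOne ℂ u v) = ψ' (rankOne ℂ u v)) (A : H →L[ℂ] H) (F : Finset ι) :
    ψ (b.finProj F * A * b.finProj F) = ψ' (b.finProj F * A * b.finProj F) := by
  simp only [HilbertBasis.finProj, Finset.sum_mul, Finset.mul_sum, map_sum]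
  refine Finset.sum_congr rfl fun i _ => Finset.sum_congr rfl fun j _ => ?_
  rw [mul_assoc, ContinuousLinearMap.mul_def, ContinuousLinearMap.mul_def,
    comp_rankOne, rankOne_comp_rankOne, map_smul, map_smul, h]

/-- A positive tight functional on `B(H)` is of the form `A ↦ ∑ₙ ⟨zₙ, A zₙ⟩`. -/
theorem IsTight.exists_predualFunctional {b : HilbertBasis ι ℂ H} {ψ : (H →L[ℂ] H) →L[ℂ] ℂ}
    (hψ : ∀ A, 0 ≤ A → 0 ≤ ψ A) (ht : IsTight b ψ) :
    ∃ z : lp (fun _ : ℕ => H) 2, ∀ A, ψ A = predualFunctional z z A := by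
  set B : H →L⋆[ℂ] H →L[ℂ] ℂ :=
    (ContinuousLinearMap.compL ℂ H (H →L[ℂ] H) ℂ ψ).comp (rankOne ℂ (E := H) (F := H)).flip with hB
  -- The density operator of `ψ`, obtained by Riesz from its values on rank-one operators.
  set K := continuousLinearMapOfBilin B with hK
  have hKi : ∀ v w, inner ℂ (K v) w = ψ (rankOne ℂ w v) := fun v w => by
    rw [hK, continuousLinearMapOfBilin_apply]
    rfl
  have hK0 : 0 ≤ K := by
    rw [ContinuousLinearMap.nonneg_iff_isPositive, ContinuousLinearMap.isPositive_iff_complex]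
    intro v
    rw [hKi]
    have h0 := hψ _ ((ContinuousLinearMap.nonneg_iff_isPositive _).2
      (isPositive_rankOne_self (𝕜 := ℂ) v))
    exact ⟨(Complex.eq_re_of_ofReal_le h0).symm, (Complex.nonneg_iff.1 h0).1⟩
  set S := CFC.sqrt K with hS
  have hSS : S * S = K := CFC.sqrt_mul_sqrt_self K hK0
  have hSa : ∀ v w, inner ℂ (S v) w = inner ℂ v (S w) := by
    have : IsSelfAdjoint S := (CFC.sqrt_nonneg K).isSelfAdjoint
    exact fun v w => this.isSymmetric v w
  have hSK : ∀ v w, inner ℂ (S v) (S w) = ψ (rankOne ℂ w v) := by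
    intro v w
    rw [← hKi, ← hSS, mul_apply_eq_comp, hSa (S v) w]
  -- The sums of `‖S (b i)‖ ^ 2` over finite sets are the values `ψ (P_F)`, so tightness says that
  -- `√K` is Hilbert–Schmidt. The vectors `S (b i)` then represent `ψ`.
  have hx : Summable fun i => ‖S (b i)‖ ^ 2 := by
    refine ⟨(ψ 1).re, ?_⟩
    have h := (Complex.continuous_re.tendsto _).comp ht
    refine h.congr fun F => ?_
    simp only [Function.comp, HilbertBasis.finProj, map_sum, Complex.re_sum, ← hSK]
    exact Finset.sum_congr rfl fun i _ => inner_self_eq_norm_sq (𝕜 := ℂ) _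
  obtain ⟨z, hz⟩ := exists_predualFunctional_eq_tsum hx
  refine ⟨z, fun A => ?_⟩
  -- Parseval gives agreement on rank-one operators; tightness of both functionals extends it to all
  -- `A`.
  have hrank : ∀ u v, ψ (rankOne ℂ u v) = predualCLM z z (rankOne ℂ u v) := by
    intro u v
    rw [predualCLM_apply, hz, ← hSK, ← b.tsum_inner_mul_inner]
    refine tsum_congr fun i => ?_
    rw [rankOne_apply, inner_smul_right, hSa, hSa]
  refine tendsto_nhds_unique (ht.tendsto_compress hψ A) ?_
  simp_rw [apply_compress_eq hrank]
  exact (isTight_predualCLM b z z).tendsto_compress (fun A => predualFunctional_nonneg z) A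

theorem isNormalMap_of_tight {b : HilbertBasis ι ℂ H} {φ : (H →L[ℂ] H) →L[ℂ] (H →L[ℂ] H)}
    (hφ : ∀ A, 0 ≤ A → 0 ≤ φ A) (ht : ∀ x, IsTight b ((predualCLM x x).comp φ)) :
    IsNormalMap φ :=
  isNormalMap_of_diag fun x => (ht x).exists_predualFunctional
    fun _ hA => predualFunctional_nonneg x (hφ _ hA)

theorem IsNormalMap.isTight {φ : (H →L[ℂ] H) →L[ℂ] (H →L[ℂ] H)} (hφ : IsNormalMap φ)
    (b : HilbertBasis ι ℂ H) (x y : lp (fun _ : ℕ => H) 2) :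
    IsTight b ((predualCLM x y).comp φ) := by
  let := sigmaWeak H
  have h1 : Continuous (fun A => predualFunctional x y (φ A)) :=
    (predualFunctional_continuous x y).comp hφ
  exact (h1.tendsto 1).comp b.sigmaWeakTendsto_finProj

/-- The form in which normality is used later: pulling a diagonal functional back along `φ` gives
another one, so formulas known for all diagonal functionals can be applied after `φ`. -/
theorem IsNormalMap.exists_predualFunctional {φ : (H →L[ℂ] H) →L[ℂ] (H →L[ℂ] H)}
    (hφ : IsNormalMap φ) (hpos : ∀ A, 0 ≤ A → 0 ≤ φ A) (x : lp (fun _ : ℕ => H) 2) :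
    ∃ z : lp (fun _ : ℕ => H) 2, ∀ A, predualFunctional x x (φ A) = predualFunctional z z A := by
  obtain ⟨w, b, -⟩ := exists_hilbertBasis ℂ H
  exact (hφ.isTight b x x).exists_predualFunctional
    fun _ hA => predualFunctional_nonneg x (hpos _ hA)

end Tight

/-! ### Positive operator matrices and complete positivity. -/

theorem CStarAlgebra.exists_eq_star_mul_self {A : Type*} [CStarAlgebra A] [PartialOrder A]
    [StarOrderedRing A] {a : A} (ha : 0 ≤ a) : ∃ b, a = star b * b :=
  CStarAlgebra.nonneg_iff_eq_star_mul_self.1 ha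

theorem IsSelfAdjoint.exists_eq_sub_of_mul_eq_zero {A : Type*} [CStarAlgebra A] [PartialOrder A]
    [StarOrderedRing A] {a : A} (ha : IsSelfAdjoint a) :
    ∃ p m : A, 0 ≤ p ∧ 0 ≤ m ∧ a = p - m ∧ p * m = 0 :=
  ⟨a⁺, a⁻, CFC.posPart_nonneg a, CFC.negPart_nonneg a, (CFC.posPart_sub_negPart a ha).symm,
    CFC.posPart_mul_negPart a⟩

section CompletelyPositive

variable {H : Type*} [NormedAddCommGroup H] [InnerProductSpace ℂ H] {n : ℕ}

/-- The sesquilinear form of a matrix of operators. -/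
def CStarMatrix.form (M : CStarMatrix (Fin n) (Fin n) (H →L[ℂ] H)) (v w : Fin n → H) : ℂ :=
  ∑ i, ∑ j, inner ℂ (v i) (M i j (w j))

/-- The action of a matrix of operators on a tuple of vectors. -/
def CStarMatrix.act (M : CStarMatrix (Fin n) (Fin n) (H →L[ℂ] H)) (w : Fin n → H) (i : Fin n) : H :=
  ∑ j, M i j (w j)

theorem CStarMatrix.form_eq_sum_inner_act (M : CStarMatrix (Fin n) (Fin n) (H →L[ℂ] H))
    (v w : Fin n → H) : M.form v w = ∑ i, inner ℂ (v i) (M.act w i) := by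
  simp [CStarMatrix.form, CStarMatrix.act]

theorem CStarMatrix.act_mul (M N : CStarMatrix (Fin n) (Fin n) (H →L[ℂ] H)) (w : Fin n → H) :
    (M * N).act w = M.act (N.act w) := by
  ext i
  simp only [CStarMatrix.act, CStarMatrix.mul_apply, _root_.sum_apply, map_sum]
  rw [Finset.sum_comm]
  rfl

theorem CStarMatrix.form_single [DecidableEq (Fin n)]
    (M : CStarMatrix (Fin n) (Fin n) (H →L[ℂ] H)) (i j : Fin n) (u w : H) :
    M.form (Pi.single i u) (Pi.single j w) = inner ℂ u (M i j w) := by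
  rw [CStarMatrix.form, Finset.sum_eq_single i, Finset.sum_eq_single j]
  · simp
  · intro k _ hk
    simp [hk]
  · simp
  · intro k _ hk
    simp [hk]
  · simp

theorem CStarMatrix.form_polarization (M : CStarMatrix (Fin n) (Fin n) (H →L[ℂ] H))
    (v w : Fin n → H) :
    M.form v w = (M.form (v + w) (v + w) - M.form (v - w) (v - w)
      - Complex.I * M.form (v + Complex.I • w) (v + Complex.I • w)
      + Complex.I * M.form (v - Complex.I • w) (v - Complex.I • w)) / 4 := by
  simp only [CStarMatrix.form, Finset.mul_sum, ← Finset.sum_add_distrib, ← Finset.sum_sub_distrib,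
    Finset.sum_div]
  refine Finset.sum_congr rfl fun i _ => ?_
  refine Finset.sum_congr rfl fun j _ => ?_
  simp only [Pi.add_apply, Pi.sub_apply, Pi.smul_apply,
    map_add, map_sub, map_smul, inner_add_left, inner_add_right, inner_sub_left, inner_sub_right,
    inner_smul_left, inner_smul_right, Complex.conj_I]
  linear_combination
    (inner ℂ (v i) (M i j (w j)) / 2 - inner ℂ (w i) (M i j (v j)) / 2) * Complex.I_sq

theorem CStarMatrix.eq_of_form_eq {M N : CStarMatrix (Fin n) (Fin n) (H →L[ℂ] H)}
    (h : ∀ v, M.form v v = N.form v v) : M = N := by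
  classical
  refine CStarMatrix.ext fun i j => ContinuousLinearMap.ext fun w => ext_inner_left ℂ fun u => ?_
  rw [← CStarMatrix.form_single, ← CStarMatrix.form_single, M.form_polarization,
    N.form_polarization]
  simp only [h]

variable [CompleteSpace H]

theorem CStarMatrix.form_star (M : CStarMatrix (Fin n) (Fin n) (H →L[ℂ] H)) (v w : Fin n → H) :
    (star M).form v w = star (M.form w v) := by
  simp only [CStarMatrix.form, star_sum]
  rw [Finset.sum_comm]
  refine Finset.sum_congr rfl fun i _ => Finset.sum_congr rfl fun j _ => ?_
  rw [CStarMatrix.star_apply, ContinuousLinearMap.star_eq_adjoint,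
    ContinuousLinearMap.adjoint_inner_right]
  exact (inner_conj_symm _ _).symm

theorem CStarMatrix.form_star_mul (M N : CStarMatrix (Fin n) (Fin n) (H →L[ℂ] H))
    (v w : Fin n → H) : (star M * N).form v w = ∑ i, inner ℂ (M.act v i) (N.act w i) := by
  rw [CStarMatrix.form_eq_sum_inner_act, CStarMatrix.act_mul,
    ← CStarMatrix.form_eq_sum_inner_act, CStarMatrix.form_star, CStarMatrix.form_eq_sum_inner_act,
    star_sum]
  exact Finset.sum_congr rfl fun i _ => inner_conj_symm _ _

theorem CStarMatrix.form_nonneg {M : CStarMatrix (Fin n) (Fin n) (H →L[ℂ] H)} (hM : 0 ≤ M)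
    (v : Fin n → H) : 0 ≤ M.form v v := by
  obtain ⟨N, rfl⟩ : ∃ N : CStarMatrix (Fin n) (Fin n) (H →L[ℂ] H), M = star N * N :=
    CStarAlgebra.exists_eq_star_mul_self hM
  rw [CStarMatrix.form_star_mul]
  exact Finset.sum_nonneg fun i _ => by
    rw [inner_self_eq_norm_sq_to_K]
    exact pow_nonneg (Complex.zero_le_real.2 (norm_nonneg (N.act v i))) 2

/-- A matrix of operators is positive if and only if its quadratic form is. -/
theorem CStarMatrix.nonneg_iff_form_nonneg {M : CStarMatrix (Fin n) (Fin n) (H →L[ℂ] H)} :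
    0 ≤ M ↔ ∀ v, 0 ≤ M.form v v := by
  refine ⟨CStarMatrix.form_nonneg, fun h => ?_⟩
  have hsa : IsSelfAdjoint M := CStarMatrix.eq_of_form_eq fun v => by
    rw [CStarMatrix.form_star]
    exact (h v).star_eq
  -- It remains to see that the negative part `N` vanishes. The form of `N M N = -N³` at `v` is that
  -- of `M` at `N v`, hence nonnegative; but `N³ ≥ 0`, so `N³ = 0`, then `N² = 0` and `N = 0`.
  obtain ⟨P, N, hP0, hN0, hPN, hmul⟩ : ∃ P N : CStarMatrix (Fin n) (Fin n) (H →L[ℂ] H),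
      0 ≤ P ∧ 0 ≤ N ∧ M = P - N ∧ P * N = 0 := hsa.exists_eq_sub_of_mul_eq_zero
  have hNs : star N = N := hN0.isSelfAdjoint
  have hMN : M * N = -(N * N) := by
    rw [hPN, sub_mul, hmul, zero_sub]
  have hcube : 0 ≤ star N * N * N := by
    rw [hNs, mul_assoc]
    nth_rewrite 1 [← hNs]
    rw [← mul_assoc]
    exact star_left_conjugate_nonneg hN0 N
  have hNNN : star N * N * N = 0 := by
    refine CStarMatrix.eq_of_form_eq fun v => ?_
    have h1 := CStarMatrix.form_nonneg hcube v
    have h2 : 0 ≤ (star N * (M * N)).form v v := by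
      rw [CStarMatrix.form_star_mul, CStarMatrix.act_mul, ← CStarMatrix.form_eq_sum_inner_act]
      exact h _
    have h3 : (star N * (M * N)).form v v = -(star N * N * N).form v v := by
      rw [hMN, mul_neg, mul_assoc]
      simp [CStarMatrix.form]
    rw [h3] at h2
    have h4 : (star N * N * N).form v v = 0 := le_antisymm (by simpa using h2) h1
    rw [h4]
    simp [CStarMatrix.form]
  have hNN : N * N = 0 := by
    have : star (N * N) * (N * N) = 0 := by
      rw [star_mul, hNs, mul_assoc, ← mul_assoc N N N]
      rw [hNs] at hNNN
      rw [hNNN, mul_zero]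
    exact CStarRing.star_mul_self_eq_zero_iff _ |>.1 this
  have hN1 : N = 0 := by
    refine CStarRing.star_mul_self_eq_zero_iff _ |>.1 ?_
    rw [hNs, hNN]
  rwa [hPN, hN1, sub_zero]

/-- For fixed `M` and `v` the form is a finite sum of matrix coefficients of `φ`, so this version
visibly survives limits and integrals. -/
theorem isCompletelyPositive_iff_form {φ : (H →L[ℂ] H) →L[ℂ] (H →L[ℂ] H)} :
    IsCompletelyPositive φ ↔ ∀ (n : ℕ) (M : CStarMatrix (Fin n) (Fin n) (H →L[ℂ] H)), 0 ≤ M →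
      ∀ v, 0 ≤ (M.map φ).form v v := by
  simp only [IsCompletelyPositive, CStarMatrix.nonneg_iff_form_nonneg]

theorem IsCompletelyPositive.map_nonneg {φ : (H →L[ℂ] H) →L[ℂ] (H →L[ℂ] H)}
    (hφ : IsCompletelyPositive φ) {A : H →L[ℂ] H} (hA : 0 ≤ A) : 0 ≤ φ A := by
  have hM : 0 ≤ (CStarMatrix.ofMatrix fun _ _ : Fin 1 => A) := by
    refine CStarMatrix.nonneg_iff_form_nonneg.2 fun v => ?_
    rw [CStarMatrix.form, Fin.sum_univ_one, Fin.sum_univ_one]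
    exact ((ContinuousLinearMap.nonneg_iff_isPositive A).1 hA).inner_nonneg_right (v 0)
  have h := isCompletelyPositive_iff_form.1 hφ 1 _ hM
  rw [ContinuousLinearMap.nonneg_iff_isPositive, ContinuousLinearMap.isPositive_iff_complex]
  intro v
  have hv : 0 ≤ inner ℂ v (φ A v) := by
    have h' := h fun _ => v
    rwa [CStarMatrix.form, Fin.sum_univ_one, Fin.sum_univ_one] at h'
  rw [← inner_conj_symm]
  rw [Complex.nonneg_iff] at hv
  exact ⟨Complex.ext rfl (by rw [Complex.conj_im, ← hv.2]; simp), hv.1⟩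

theorem isCompletelyPositive_id :
    IsCompletelyPositive (ContinuousLinearMap.id ℂ (H →L[ℂ] H)) := fun _ _ hM => hM

theorem IsCompletelyPositive.comp {φ ψ : (H →L[ℂ] H) →L[ℂ] (H →L[ℂ] H)}
    (hφ : IsCompletelyPositive φ) (hψ : IsCompletelyPositive ψ) :
    IsCompletelyPositive (φ.comp ψ) := fun n M hM => hφ n _ (hψ n M hM)

theorem IsCompletelyPositive.pow {φ : (H →L[ℂ] H) →L[ℂ] (H →L[ℂ] H)}
    (hφ : IsCompletelyPositive φ) (k : ℕ) : IsCompletelyPositive (φ ^ k) := by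
  induction k with
  | zero => exact isCompletelyPositive_id
  | succ k ih => exact ih.comp hφ

theorem IsCompletelyPositive.add {φ ψ : (H →L[ℂ] H) →L[ℂ] (H →L[ℂ] H)}
    (hφ : IsCompletelyPositive φ) (hψ : IsCompletelyPositive ψ) :
    IsCompletelyPositive (φ + ψ) := fun n M hM => add_nonneg (hφ n M hM) (hψ n M hM)

theorem isCompletelyPositive_zero :
    IsCompletelyPositive (0 : (H →L[ℂ] H) →L[ℂ] (H →L[ℂ] H)) := fun _ _ _ => le_refl 0

theorem IsCompletelyPositive.smul {φ : (H →L[ℂ] H) →L[ℂ] (H →L[ℂ] H)}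
    (hφ : IsCompletelyPositive φ) {c : ℂ} (hc : 0 ≤ c) : IsCompletelyPositive (c • φ) := by
  refine isCompletelyPositive_iff_form.2 fun n M hM v => ?_
  have h : (M.map (c • φ)).form v v = c * (M.map φ).form v v := by
    simp [CStarMatrix.form, Finset.mul_sum]
  rw [h]
  exact mul_nonneg hc (isCompletelyPositive_iff_form.1 hφ n M hM v)

theorem IsCompletelyPositive.sum {α : Type*} {φ : α → (H →L[ℂ] H) →L[ℂ] (H →L[ℂ] H)} {s : Finset α}
    (hφ : ∀ a ∈ s, IsCompletelyPositive (φ a)) : IsCompletelyPositive (∑ a ∈ s, φ a) :=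
  Finset.sum_induction _ _ (fun _ _ => IsCompletelyPositive.add) isCompletelyPositive_zero hφ

theorem isCompletelyPositive_of_tendsto {α : Type*} {l : Filter α} [l.NeBot]
    {φ : α → (H →L[ℂ] H) →L[ℂ] (H →L[ℂ] H)} {ψ : (H →L[ℂ] H) →L[ℂ] (H →L[ℂ] H)}
    (hφ : ∀ a, IsCompletelyPositive (φ a)) (h : Tendsto φ l (𝓝 ψ)) : IsCompletelyPositive ψ := by
  refine isCompletelyPositive_iff_form.2 fun n M hM v => ?_
  refine ge_of_tendsto' (x := l) (f := fun a => (M.map (φ a)).form v v) ?_ fun a =>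
    isCompletelyPositive_iff_form.1 (hφ a) n M hM v
  refine tendsto_finsetSum _ fun i _ => tendsto_finsetSum _ fun j _ => ?_
  have hc : Continuous fun χ : (H →L[ℂ] H) →L[ℂ] (H →L[ℂ] H) =>
      inner ℂ (v i) (χ (M i j) (v j)) := by fun_prop
  exact (hc.tendsto ψ).comp h

/-- A norm limit of normal positive maps is normal. -/
theorem isNormalMap_of_tendsto {α : Type*} {l : Filter α} [l.NeBot]
    {φ : α → (H →L[ℂ] H) →L[ℂ] (H →L[ℂ] H)} {ψ : (H →L[ℂ] H) →L[ℂ] (H →L[ℂ] H)}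
    (hφ : ∀ a, IsNormalMap (φ a)) (h : Tendsto φ l (𝓝 ψ)) (hψ : ∀ A, 0 ≤ A → 0 ≤ ψ A) :
    IsNormalMap ψ := by
  obtain ⟨w, b, -⟩ := exists_hilbertBasis ℂ H
  refine isNormalMap_of_tight (b := b) hψ fun x => ?_
  set ω := predualCLM x x
  -- Since `‖P_F‖ ≤ 1`, norm convergence is uniform in `F`, which allows the limits in `a` and `F`
  -- to be exchanged.
  have hu : TendstoUniformly (fun a F => ω.comp (φ a) (b.finProj F))
      (fun F => ω.comp ψ (b.finProj F)) l := by
    rw [Metric.tendstoUniformly_iff]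
    intro ε hε
    have h0 : Tendsto (fun a => ‖ω‖ * ‖ψ - φ a‖) l (𝓝 0) := by
      simpa using ((h.const_sub ψ).norm).const_mul ‖ω‖
    filter_upwards [h0.eventually_lt_const hε] with a ha F
    refine lt_of_le_of_lt ?_ ha
    rw [dist_eq_norm]
    calc ‖ω (ψ (b.finProj F)) - ω (φ a (b.finProj F))‖ = ‖ω ((ψ - φ a) (b.finProj F))‖ := by simp
      _ ≤ ‖ω‖ * (‖ψ - φ a‖ * ‖b.finProj F‖) := by
        refine (ω.le_opNorm _).trans ?_
        gcongr
        exact (ψ - φ a).le_opNorm _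
      _ ≤ ‖ω‖ * ‖ψ - φ a‖ := by
        gcongr
        exact mul_le_of_le_one_right (norm_nonneg _) (b.norm_finProj_le F)
  refine hu.tendsto_of_eventually_tendsto
    (Eventually.of_forall fun a => (hφ a).isTight b x x) ?_
  have hc : Continuous fun χ : (H →L[ℂ] H) →L[ℂ] (H →L[ℂ] H) => ω (χ 1) := by fun_prop
  exact (hc.tendsto ψ).comp h

end CompletelyPositive

/-! ### Weak averages of the semigroup. -/

section Average

variable {H : Type*} [NormedAddCommGroup H] [InnerProductSpace ℂ H] [CompleteSpace H]

/-- A positive unital map is bounded by `4`. -/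
theorem norm_apply_le_of_unital {φ : (H →L[ℂ] H) →L[ℂ] (H →L[ℂ] H)} (hφ : ∀ A, 0 ≤ A → 0 ≤ φ A)
    (h1 : φ 1 = 1) (A : H →L[ℂ] H) : ‖φ A‖ ≤ 4 * ‖A‖ := by
  have hpos : ∀ B, 0 ≤ B → ‖φ B‖ ≤ ‖B‖ := by
    intro B hB
    rw [CStarAlgebra.norm_le_iff_le_algebraMap _ (norm_nonneg B) (hφ B hB), ← sub_nonneg]
    have hle := hφ _ (sub_nonneg.2 (IsSelfAdjoint.le_algebraMap_norm_self hB.isSelfAdjoint))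
    have hr : φ (algebraMap ℝ (H →L[ℂ] H) ‖B‖) = algebraMap ℝ (H →L[ℂ] H) ‖B‖ := by
      rw [Algebra.algebraMap_eq_smul_one, ← Complex.coe_smul, map_smul, h1]
    rwa [map_sub, hr] at hle
  -- The constant `4` counts the positive parts, each of norm at most `‖A‖`, on which `φ` is
  -- contractive. Only boundedness uniform in `φ` matters later.
  obtain ⟨y, hy0, hyn, hy⟩ := CStarAlgebra.exists_sum_four_nonneg A
  conv_lhs => rw [hy]
  rw [map_sum]
  refine (norm_sum_le _ _).trans ?_
  calc ∑ i : Fin 4, ‖φ (Complex.I ^ (i : ℕ) • y i)‖ ≤ ∑ _i : Fin 4, ‖A‖ := by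
        refine Finset.sum_le_sum fun i _ => ?_
        rw [map_smul, norm_smul, norm_pow, Complex.norm_I, one_pow, one_mul]
        exact (hpos _ (hy0 i)).trans (hyn i)
    _ = 4 * ‖A‖ := by simp

namespace QuantumDynamicalSemigroup

variable {S : QuantumDynamicalSemigroup H}

theorem map_nonneg (S : QuantumDynamicalSemigroup H) (t : ℝ≥0) {A : H →L[ℂ] H} (hA : 0 ≤ A) :
    0 ≤ S.T t A :=
  (S.completelyPositive t).map_nonneg hA

theorem continuous_predualFunctional (S : QuantumDynamicalSemigroup H)
    (x y : lp (fun _ : ℕ => H) 2) (A : H →L[ℂ] H) :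
    Continuous fun t => predualFunctional x y (S.T t A) :=
  continuous_sigmaWeak_iff.1 (S.sigmaWeak_continuous A) x y

theorem continuous_inner (S : QuantumDynamicalSemigroup H) (A : H →L[ℂ] H) (v w : H) :
    Continuous fun t => inner ℂ v (S.T t A w) := by
  simpa only [predualFunctional_single] using
    S.continuous_predualFunctional (lp.single 2 0 v) (lp.single 2 0 w) A

theorem IsMarkov.norm_apply_le (hS : S.IsMarkov) (t : ℝ≥0) (A : H →L[ℂ] H) :
    ‖S.T t A‖ ≤ 4 * ‖A‖ :=
  norm_apply_le_of_unital (fun _ => S.map_nonneg t) (hS t) A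

theorem IsMarkov.norm_inner_le (hS : S.IsMarkov) (t : ℝ≥0) (A : H →L[ℂ] H) (v w : H) :
    ‖inner ℂ v (S.T t A w)‖ ≤ ‖v‖ * ‖w‖ * (4 * ‖A‖) :=
  (norm_inner_apply_le _ _ _).trans (by gcongr; exact hS.norm_apply_le t A)

theorem IsMarkov.norm_predualFunctional_le (hS : S.IsMarkov) (t : ℝ≥0)
    (x y : lp (fun _ : ℕ => H) 2) (A : H →L[ℂ] H) :
    ‖predualFunctional x y (S.T t A)‖ ≤ (∑' n, ‖x n‖ * ‖y n‖) * (4 * ‖A‖) :=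
  (_root_.norm_predualFunctional_le _ _ _).trans
    (mul_le_mul_of_nonneg_left (hS.norm_apply_le t A) (tsum_nonneg fun _ => by positivity))

variable (μ : Measure ℝ≥0) [IsProbabilityMeasure μ]

theorem IsMarkov.integrable_inner (hS : S.IsMarkov) (A : H →L[ℂ] H) (v w : H) :
    Integrable (fun t => inner ℂ v (S.T t A w)) μ :=
  Integrable.of_bound (S.continuous_inner A v w).aestronglyMeasurable _
    (ae_of_all _ fun t => hS.norm_inner_le t A v w)

theorem IsMarkov.norm_integral_inner_le (hS : S.IsMarkov) (A : H →L[ℂ] H) (v w : H) :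
    ‖∫ t, inner ℂ v (S.T t A w) ∂μ‖ ≤ 4 * ‖A‖ * ‖v‖ * ‖w‖ := by
  refine (norm_integral_le_of_norm_le_const (ae_of_all _ fun t => hS.norm_inner_le t A v w)).trans ?_
  simp only [probReal_univ, mul_one]
  exact le_of_eq (by ring)

/-- The sesquilinear form `(w, v) ↦ ∫ ⟨T t A w, v⟩ dμ(t)`. -/
def IsMarkov.averageForm (hS : S.IsMarkov) (A : H →L[ℂ] H) : H →L⋆[ℂ] H →L[ℂ] ℂ :=
  LinearMap.mkContinuous₂
    (LinearMap.mk₂'ₛₗ (starRingEnd ℂ) (RingHom.id ℂ)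
      -- The conjugate makes the form antilinear in `w`, as the Riesz construction below expects.
      (fun w v => starRingEnd ℂ (∫ t, inner ℂ v (S.T t A w) ∂μ))
      (fun w w' v => by
        simp only [_root_.map_add, inner_add_right]
        rw [integral_add (hS.integrable_inner μ A v w) (hS.integrable_inner μ A v w'), _root_.map_add])
      (fun c w v => by
        simp only [_root_.map_smul, inner_smul_right]
        rw [integral_const_mul, map_mul, smul_eq_mul])
      (fun w v v' => by
        simp only [inner_add_left]
        rw [integral_add (hS.integrable_inner μ A v w) (hS.integrable_inner μ A v' w), _root_.map_add])
      (fun c w v => by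
        simp only [inner_smul_left]
        rw [integral_const_mul, map_mul, Complex.conj_conj]
        rfl))
    (4 * ‖A‖) fun w v => by
      refine (RCLike.norm_conj _).trans_le ((hS.norm_integral_inner_le μ A v w).trans_eq (by ring))

/-- The average `∫ T t dμ(t)` of a quantum Markov semigroup under a probability measure. -/
def IsMarkov.average (hS : S.IsMarkov) : (H →L[ℂ] H) →L[ℂ] (H →L[ℂ] H) :=
  LinearMap.mkContinuous
    { toFun := fun A => continuousLinearMapOfBilin (hS.averageForm μ A)
      map_add' := fun A B => by
        refine ContinuousLinearMap.ext fun w => ext_inner_right ℂ fun v => ?_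
        rw [add_apply, inner_add_left]
        simp only [continuousLinearMapOfBilin_apply]
        change starRingEnd ℂ (∫ t, inner ℂ v (S.T t (A + B) w) ∂μ) = _
        simp only [_root_.map_add, add_apply, inner_add_right]
        rw [integral_add (hS.integrable_inner μ A v w) (hS.integrable_inner μ B v w),
          _root_.map_add]
        rfl
      map_smul' := fun c A => by
        refine ContinuousLinearMap.ext fun w => ext_inner_right ℂ fun v => ?_
        rw [smul_apply, inner_smul_left]
        simp only [continuousLinearMapOfBilin_apply]
        change starRingEnd ℂ (∫ t, inner ℂ v (S.T t (c • A) w) ∂μ) = _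
        simp only [_root_.map_smul, smul_apply, inner_smul_right]
        rw [integral_const_mul, map_mul]
        rfl }
    4 fun A => by
      refine ContinuousLinearMap.opNorm_le_bound _ (by positivity) fun w => ?_
      set B := continuousLinearMapOfBilin (hS.averageForm μ A) with hB
      change ‖B w‖ ≤ _
      have h : ‖inner ℂ (B w) (B w)‖ ≤ 4 * ‖A‖ * ‖w‖ * ‖B w‖ := by
        rw [hB, continuousLinearMapOfBilin_apply]
        refine (RCLike.norm_conj _).trans_le ((hS.norm_integral_inner_le μ A _ w).trans_eq ?_)
        ring
      rw [inner_self_eq_norm_sq_to_K, norm_pow, RCLike.norm_ofReal, abs_norm, sq] at h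
      by_cases h0 : ‖B w‖ = 0
      · rw [h0]
        positivity
      · exact le_of_mul_le_mul_right h ((norm_nonneg _).lt_of_ne' h0)

theorem IsMarkov.inner_average (hS : S.IsMarkov) (A : H →L[ℂ] H) (v w : H) :
    inner ℂ v (hS.average μ A w) = ∫ t, inner ℂ v (S.T t A w) ∂μ := by
  rw [← inner_conj_symm]
  change starRingEnd ℂ (inner ℂ (continuousLinearMapOfBilin (hS.averageForm μ A) w) v) = _
  rw [continuousLinearMapOfBilin_apply]
  exact Complex.conj_conj _

/-- Sum and integral commute, since the terms are bounded uniformly in `t` by a summable sequence.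
The weakly defined average is thereby also a σ-weak integral. -/
theorem IsMarkov.predualFunctional_average (hS : S.IsMarkov) (x y : lp (fun _ : ℕ => H) 2)
    (A : H →L[ℂ] H) :
    predualFunctional x y (hS.average μ A) = ∫ t, predualFunctional x y (S.T t A) ∂μ := by
  simp only [predualFunctional, hS.inner_average μ]
  refine integral_tsum_of_summable_integral_norm (fun n => hS.integrable_inner μ A _ _) ?_
  refine Summable.of_nonneg_of_le (fun n => integral_nonneg fun _ => norm_nonneg _) (fun n => ?_)
    ((lp_two_summable_norm_mul_norm x y).mul_right (4 * ‖A‖))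
  refine (integral_mono_of_nonneg (ae_of_all _ fun _ => norm_nonneg _) (integrable_const _)
    (ae_of_all _ fun t => hS.norm_inner_le t A (x n) (y n))).trans_eq ?_
  simp

theorem IsMarkov.average_one (hS : S.IsMarkov) : hS.average μ 1 = 1 := by
  refine ContinuousLinearMap.ext fun w => ext_inner_left ℂ fun v => ?_
  rw [hS.inner_average μ]
  simp [hS _]

theorem IsMarkov.isCompletelyPositive_average (hS : S.IsMarkov) :
    IsCompletelyPositive (hS.average μ) := by
  refine isCompletelyPositive_iff_form.2 fun n M hM v => ?_
  have key : ∀ B : Fin n → Fin n → H →L[ℂ] H,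
      ∑ i, ∑ j, ∫ t, inner ℂ (v i) (S.T t (B i j) (v j)) ∂μ
        = ∫ t, ∑ i, ∑ j, inner ℂ (v i) (S.T t (B i j) (v j)) ∂μ := by
    intro B
    rw [integral_finsetSum _ fun i _ => integrable_finsetSum _ fun j _ =>
      hS.integrable_inner μ _ _ _]
    refine Finset.sum_congr rfl fun i _ => ?_
    rw [integral_finsetSum _ fun j _ => hS.integrable_inner μ _ _ _]
  have h : (M.map (hS.average μ)).form v v = ∫ t, (M.map (S.T t)).form v v ∂μ := by
    simp only [CStarMatrix.form, CStarMatrix.map_apply, hS.inner_average μ]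
    exact key fun i j => M i j
  rw [h]
  exact integral_nonneg fun t => isCompletelyPositive_iff_form.1 (S.completelyPositive t) n M hM v

/-- By the tightness criterion it suffices that `∫ ω (T t (1 - P_F)) dμ → 0` for each diagonal
functional `ω`. The finite sets form a net, so sequential convergence theorems do not apply. Instead
the integrands are continuous and decrease to `0` pointwise, hence uniformly on compact sets by
Dini, and tightness of `μ` controls the complement. -/
theorem IsMarkov.isNormalMap_average (hS : S.IsMarkov) : IsNormalMap (hS.average μ) := by
  obtain ⟨w, b, -⟩ := exists_hilbertBasis ℂ H
  refine isNormalMap_of_tight (b := b)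
    (fun A => (hS.isCompletelyPositive_average μ).map_nonneg) fun x => ?_
  set g : Finset w → ℝ≥0 → ℝ := fun F t => (predualFunctional x x (S.T t (1 - b.finProj F))).re
    with hg
  have hgc : ∀ F, Continuous (g F) := fun F =>
    Complex.continuous_re.comp (S.continuous_predualFunctional x x _)
  have hg0 : ∀ F t, 0 ≤ g F t := fun F t => (Complex.nonneg_iff.1
    (predualFunctional_nonneg x (S.map_nonneg t (sub_nonneg.2 (b.finProj_le_one F))))).1
  have hgmono : Antitone g := by
    intro F G hFG t
    have h := predualFunctional_nonneg x (S.map_nonneg t (sub_nonneg.2 (b.finProj_mono hFG)))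
    have h' := (Complex.nonneg_iff.1 h).1
    have hd : g F t - g G t
        = (predualFunctional x x (S.T t (b.finProj G - b.finProj F))).re := by
      simp only [hg, ← predualCLM_apply, map_sub, Complex.sub_re]
      ring
    linarith
  have hglim : ∀ t, Tendsto (g · t) atTop (𝓝 0) := by
    intro t
    have h := (S.normal t).isTight b x x
    have h2 := (Complex.continuous_re.tendsto _).comp (h.const_sub (predualCLM x x (S.T t 1)))
    simpa [hg, Function.comp_def, ← predualCLM_apply] using h2
  -- As the empty projection is `0` and `T t 1 = 1`, this is `ω 1`, a bound independent of `t`.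
  set C : ℝ := g ∅ 0 with hC
  have hgC : ∀ F t, g F t ≤ C := by
    intro F t
    refine (hgmono (Finset.empty_subset F) t).trans_eq ?_
    simp only [hC, hg, HilbertBasis.finProj, Finset.sum_empty, sub_zero, hS _]
  have hC0 : 0 ≤ C := hg0 _ _
  have hint : Tendsto (fun F => ∫ t, g F t ∂μ) atTop (𝓝 0) := by
    refine tendsto_order.2 ⟨fun a ha => Eventually.of_forall fun F =>
      ha.trans_le (integral_nonneg (hg0 F)), fun a ha => ?_⟩
    obtain ⟨K, hK, hKμ⟩ : ∃ K : Set ℝ≥0, IsCompact K ∧ C * μ.real Kᶜ < a / 2 := by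
      -- `C + 1` rather than `C` in the denominator, since `C` may vanish.
      have hε : 0 < a / (2 * (C + 1)) := by positivity
      obtain ⟨K, hK, h⟩ := isTightMeasureSet_iff_exists_isCompact_measure_compl_le.1
        (isTightMeasureSet_singleton (μ := μ)) (ENNReal.ofReal (a / (2 * (C + 1))))
        (ENNReal.ofReal_pos.2 hε)
      refine ⟨K, hK, ?_⟩
      have h1 : μ.real Kᶜ ≤ a / (2 * (C + 1)) :=
        ENNReal.toReal_le_of_le_ofReal hε.le (h μ rfl)
      calc C * μ.real Kᶜ ≤ C * (a / (2 * (C + 1))) := by gcongr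
        _ < (C + 1) * (a / (2 * (C + 1))) := by gcongr; linarith
        _ = a / 2 := by field_simp
    have hD := Antitone.tendstoUniformlyOn_of_forall_tendsto hK (fun F => (hgc F).continuousOn)
      (fun t _ F G hFG => hgmono hFG t) (continuousOn_const (c := (0 : ℝ))) fun t _ => hglim t
    filter_upwards [Metric.tendstoUniformlyOn_iff.1 hD (a / 2) (by positivity)] with F hF
    have hgi : Integrable (g F) μ := Integrable.of_bound (hgc F).aestronglyMeasurable C
      (ae_of_all _ fun t => by rw [Real.norm_of_nonneg (hg0 F t)]; exact hgC F t)
    rw [← integral_add_compl hK.measurableSet hgi]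
    have h1 : ∫ t in K, g F t ∂μ ≤ a / 2 := by
      calc ∫ t in K, g F t ∂μ ≤ ∫ _ in K, a / 2 ∂μ := by
            refine setIntegral_mono_on hgi.integrableOn (integrable_const _) hK.measurableSet
              fun t ht => ?_
            have := hF t ht
            rw [Real.dist_eq, zero_sub, abs_neg] at this
            exact (le_abs_self _).trans this.le
        _ ≤ a / 2 := by
            rw [setIntegral_const, smul_eq_mul]
            exact mul_le_of_le_one_left (by positivity) measureReal_le_one
    have h2 : ∫ t in Kᶜ, g F t ∂μ ≤ C * μ.real Kᶜ := by
      calc ∫ t in Kᶜ, g F t ∂μ ≤ ∫ _ in Kᶜ, C ∂μ :=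
            setIntegral_mono_on hgi.integrableOn (integrable_const _) hK.measurableSet.compl
              fun t _ => hgC F t
        _ = C * μ.real Kᶜ := by rw [setIntegral_const, smul_eq_mul, mul_comm]
    linarith
  have heq : ∀ F, predualCLM x x (hS.average μ (b.finProj F))
      = predualCLM x x (hS.average μ 1) - ((∫ t, g F t ∂μ : ℝ) : ℂ) := by
    intro F
    rw [← integral_complex_ofReal, eq_sub_iff_add_eq, ← eq_sub_iff_add_eq', ← map_sub, ← map_sub,
      predualCLM_apply, hS.predualFunctional_average μ]
    refine integral_congr_ae (ae_of_all _ fun t => ?_)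
    exact (Complex.eq_re_of_ofReal_le (predualFunctional_nonneg x
      (S.map_nonneg t (sub_nonneg.2 (b.finProj_le_one F))))).symm
  have hfin := ((Complex.continuous_ofReal.tendsto _).comp hint).const_sub
    (predualCLM x x (hS.average μ 1))
  rw [Complex.ofReal_zero, sub_zero] at hfin
  exact hfin.congr fun F => (heq F).symm

theorem exists_predualFunctional (S : QuantumDynamicalSemigroup H) (t : ℝ≥0)
    (x : lp (fun _ : ℕ => H) 2) :
    ∃ z : lp (fun _ : ℕ => H) 2, ∀ A, predualFunctional x x (S.T t A) = predualFunctional z z A :=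
  (S.normal t).exists_predualFunctional (fun _ => S.map_nonneg t) x

/-- `T h` passes under the weak integral because, by normality, the functional composed with `T h`
is again diagonal. -/
theorem IsMarkov.predualFunctional_apply_average (hS : S.IsMarkov) (h : ℝ≥0)
    (x : lp (fun _ : ℕ => H) 2) (A : H →L[ℂ] H) :
    predualFunctional x x (S.T h (hS.average μ A))
      = ∫ t, predualFunctional x x (S.T (h + t) A) ∂μ := by
  obtain ⟨z, hz⟩ := S.exists_predualFunctional h x
  simp only [S.map_add, hz, hS.predualFunctional_average μ]

end QuantumDynamicalSemigroup

end Average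

/-! ### Exponential laws and one-sided derivatives. -/

section ExponentialLaw

/-- The law of `ε X`, where `X` is a standard exponential random variable. -/
def expLaw (ε : ℝ) : Measure ℝ≥0 :=
  ((volume.restrict (Set.Ioi (0 : ℝ))).withDensity fun s => ENNReal.ofReal (Real.exp (-s))).map
    fun s => (ε * s).toNNReal

/-- No sign condition is needed: for `ε ≤ 0` truncation by `toNNReal` makes the law the unit mass at
`0`. -/
instance (ε : ℝ) : IsProbabilityMeasure (expLaw ε) := by
  have : IsProbabilityMeasure ((volume.restrict (Set.Ioi (0 : ℝ))).withDensity
      fun s => ENNReal.ofReal (Real.exp (-s))) := by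
    refine ⟨?_⟩
    rw [withDensity_apply _ MeasurableSet.univ, Measure.restrict_univ,
      ← ofReal_integral_eq_lintegral_ofReal (integrableOn_exp_neg_Ioi 0)
        (ae_of_all _ fun _ => (Real.exp_pos _).le), integral_exp_neg_Ioi_zero, ENNReal.ofReal_one]
  exact Measure.isProbabilityMeasure_map (by fun_prop)

theorem integral_expLaw (ε : ℝ) {f : ℝ≥0 → ℂ} (hf : Continuous f) :
    ∫ t, f t ∂expLaw ε = ∫ s in Set.Ioi (0 : ℝ), Real.exp (-s) • f (ε * s).toNNReal := by
  rw [expLaw, integral_map (by fun_prop) hf.aestronglyMeasurable,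
    integral_withDensity_eq_integral_toReal_smul (by fun_prop) (ae_of_all _ fun _ => by simp)]
  simp only [ENNReal.toReal_ofReal (Real.exp_pos _).le]

variable {f : ℝ≥0 → ℂ} {C : ℝ}

theorem integrableOn_exp_neg_smul {g : ℝ → ℂ} (hg : Continuous g) (hC : ∀ s, ‖g s‖ ≤ C) (a : ℝ) :
    IntegrableOn (fun s => Real.exp (-s) • g s) (Set.Ioi a) := by
  refine ((integrableOn_exp_neg_Ioi a).mul_const C).mono'
    (by fun_prop) (ae_of_all _ fun s => ?_)
  rw [norm_smul, Real.norm_of_nonneg (Real.exp_pos _).le]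
  exact mul_le_mul_of_nonneg_left (hC s) (Real.exp_pos _).le

theorem tendsto_integral_expLaw (hf : Continuous f) (hC : ∀ t, ‖f t‖ ≤ C) :
    Tendsto (fun ε => ∫ t, f t ∂expLaw ε) (𝓝[>] 0) (𝓝 (f 0)) := by
  simp_rw [integral_expLaw _ hf]
  have h0 : f 0 = ∫ s in Set.Ioi (0 : ℝ), Real.exp (-s) • f 0 := by
    rw [integral_smul_const, integral_exp_neg_Ioi_zero, one_smul]
  rw [h0]
  refine tendsto_integral_filter_of_dominated_convergence (fun s => Real.exp (-s) * C)
    (Eventually.of_forall fun ε => by fun_prop) (Eventually.of_forall fun ε => ae_of_all _ fun s => ?_)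
    ((integrableOn_exp_neg_Ioi 0).mul_const C) (ae_of_all _ fun s => ?_)
  · rw [norm_smul, Real.norm_of_nonneg (Real.exp_pos _).le]
    exact mul_le_mul_of_nonneg_left (hC _) (Real.exp_pos _).le
  · have hc : Continuous fun ε : ℝ => Real.exp (-s) • f (ε * s).toNNReal := by fun_prop
    simpa using (hc.tendsto 0).mono_left nhdsWithin_le_nhds

/-- Right difference quotients over `ℝ≥0` compute right derivatives over `ℝ`. -/
theorem hasDerivWithinAt_Ici_iff_nnreal {F : ℝ → ℂ} {t : ℝ} {c : ℂ} :
    HasDerivWithinAt F c (Set.Ici t) t ↔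
      Tendsto (fun h : ℝ≥0 => ((h : ℝ) : ℂ)⁻¹ * (F (t + h) - F t)) (𝓝[>] 0) (𝓝 c) := by
  rw [← hasDerivWithinAt_Ioi_iff_Ici, hasDerivWithinAt_iff_tendsto_slope' Set.self_notMem_Ioi]
  have hs : ∀ h : ℝ≥0, slope F t (t + h) = ((h : ℝ) : ℂ)⁻¹ * (F (t + h) - F t) := by
    intro h
    rw [slope_def_module, add_sub_cancel_left, ← Complex.coe_smul, Complex.ofReal_inv, smul_eq_mul]
  constructor
  · intro H
    have hm : Tendsto (fun h : ℝ≥0 => t + (h : ℝ)) (𝓝[>] 0) (𝓝[>] t) := by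
      refine tendsto_nhdsWithin_iff.2 ⟨?_, ?_⟩
      · have : Continuous fun h : ℝ≥0 => t + (h : ℝ) := by fun_prop
        simpa using (this.tendsto 0).mono_left nhdsWithin_le_nhds
      · filter_upwards [self_mem_nhdsWithin] with h hh
        exact lt_add_of_pos_right t (NNReal.coe_pos.2 hh)
    exact (H.comp hm).congr hs
  · intro H
    have hm : Tendsto (fun y : ℝ => (y - t).toNNReal) (𝓝[>] t) (𝓝[>] 0) := by
      refine tendsto_nhdsWithin_iff.2 ⟨?_, ?_⟩
      · have : Continuous fun y : ℝ => (y - t).toNNReal := by fun_prop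
        simpa using (this.tendsto t).mono_left nhdsWithin_le_nhds
      · filter_upwards [self_mem_nhdsWithin] with y hy
        exact Real.toNNReal_pos.2 (sub_pos.2 hy)
    refine (H.comp hm).congr' ?_
    filter_upwards [self_mem_nhdsWithin] with y hy
    rw [Function.comp_apply, ← hs, Real.coe_toNNReal _ (sub_pos.2 hy).le, add_sub_cancel]

/-- With `g u = exp (-u) f (ε u)` and `I = ∫ g` over `(0, ∞)`, the substitution `u = s + h/ε` turns
the shifted integral into `exp (h/ε) (I - ∫ g over [0, h/ε])`. Its derivative at `h = 0` is `ε⁻¹ (I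
- f 0)`. -/
theorem tendsto_integral_expLaw_add {ε : ℝ} (hε : 0 < ε) (hf : Continuous f)
    (hC : ∀ t, ‖f t‖ ≤ C) :
    Tendsto (fun h : ℝ≥0 => ((h : ℝ) : ℂ)⁻¹ *
        (∫ t, f (h + t) ∂expLaw ε - ∫ t, f t ∂expLaw ε)) (𝓝[>] 0)
      (𝓝 ((ε : ℂ)⁻¹ * (∫ t, f t ∂expLaw ε - f 0))) := by
  set g : ℝ → ℂ := fun u => Real.exp (-u) • f (ε * u).toNNReal with hg
  have hgc : Continuous g := by fun_prop
  have hgi : ∀ a, IntegrableOn g (Set.Ioi a) := fun a =>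
    integrableOn_exp_neg_smul (by fun_prop) (fun s => hC _) a
  set I := ∫ t, f t ∂expLaw ε with hI
  have hI' : I = ∫ u in Set.Ioi 0, g u := integral_expLaw ε hf
  set Φ : ℝ → ℂ := fun h => Complex.exp ((h / ε : ℝ) : ℂ) * (I - ∫ u in (0 : ℝ)..h / ε, g u) with hΦ
  have hΦ0 : Φ 0 = I := by simp [hΦ]
  have hΦh : ∀ h : ℝ≥0, Φ h = ∫ t, f (h + t) ∂expLaw ε := by
    intro h
    have ha : 0 ≤ (h : ℝ) / ε := by positivity
    have h1 : I - ∫ u in (0 : ℝ)..h / ε, g u = ∫ u in Set.Ioi (h / ε : ℝ), g u := by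
      rw [hI', ← intervalIntegral.integral_interval_add_Ioi (hgi 0) (hgi (h / ε : ℝ)),
        add_sub_cancel_left]
    rw [hΦ, integral_expLaw ε (f := fun t => f (h + t)) (by fun_prop)]
    dsimp only
    rw [h1, ← integral_const_mul]
    have hmp := (measurePreserving_add_right volume (h / ε : ℝ)).setIntegral_preimage_emb
      (measurableEmbedding_addRight (h / ε : ℝ))
      (fun u => Complex.exp ((h / ε : ℝ) : ℂ) * g u) (Set.Ioi (h / ε : ℝ))
    rw [← hmp, Set.preimage_add_const_Ioi, sub_self]
    refine setIntegral_congr_fun measurableSet_Ioi fun s hs => ?_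
    have hs0 : 0 ≤ ε * s := mul_nonneg hε.le (Set.mem_Ioi.1 hs).le
    have harg : (ε * (s + h / ε)).toNNReal = h + (ε * s).toNNReal := by
      rw [mul_add, mul_div_cancel₀ _ hε.ne', add_comm (ε * s), Real.toNNReal_add h.coe_nonneg hs0,
        Real.toNNReal_coe]
    simp only [hg, harg, Complex.real_smul, Complex.ofReal_exp, ← mul_assoc, ← Complex.exp_add]
    congr 2
    push_cast
    ring
  have hd : HasDerivAt Φ ((ε : ℂ)⁻¹ * (I - f 0)) 0 := by
    have hdiv : HasDerivAt (fun h : ℝ => h / ε) (1 / ε) 0 := (hasDerivAt_id 0).div_const ε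
    have h1 : HasDerivAt (fun a : ℝ => ∫ u in (0 : ℝ)..a, g u) (g 0) ((0 : ℝ) / ε) := by
      have := hgc.integral_hasStrictDerivAt 0 (0 / ε)
      simpa using this.hasDerivAt
    have h2 : HasDerivAt (fun h : ℝ => I - ∫ u in (0 : ℝ)..h / ε, g u) (-((1 / ε) • g 0)) 0 := by
      have h2' := h1.scomp 0 hdiv
      exact h2'.const_sub I
    have h3 : HasDerivAt (fun h : ℝ => Complex.exp ((h / ε : ℝ) : ℂ))
        (Complex.exp ((0 / ε : ℝ) : ℂ) * ((1 / ε : ℝ) : ℂ)) 0 := hdiv.ofReal_comp.cexp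
    refine (h3.mul h2).congr_deriv ?_
    simp [hg]
    ring
  have h := hasDerivWithinAt_Ici_iff_nnreal.1 hd.hasDerivWithinAt
  simpa only [zero_add, hΦ0, hΦh] using h

end ExponentialLaw

/-! ### Right inverses of `1 - ε L`. -/

section RightInverse

variable {E : Type*} [NormedAddCommGroup E] [NormedSpace ℂ E] {L : E →ₗ.[ℂ] E} {ε : ℝ}
  {R M : E →L[ℂ] E}

/-- If `1 - ε L` is injective and `R` is a right inverse of it, then `ε⁻¹ (R - 1)` is
`L (1 - ε L)⁻¹`. -/
theorem isResolventComposite_of_right_inverse (hε : ε ≠ 0)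
    (hM : ∀ A, M A = (ε : ℂ)⁻¹ • (R A - A))
    (hR : ∀ A, ∃ h : R A ∈ L.domain, L ⟨R A, h⟩ = (ε : ℂ)⁻¹ • (R A - A))
    (hL : ∀ A : L.domain, L A = (ε : ℂ)⁻¹ • (A : E) → (A : E) = 0) :
    IsResolventComposite L ε M := by
  have hε' : (ε : ℂ) ≠ 0 := Complex.ofReal_ne_zero.2 hε
  have hsurj : ∀ A, (L.domain.subtype - (ε : ℂ) • L.toFun) ⟨R A, (hR A).1⟩ = A := by
    intro A
    change R A - (ε : ℂ) • L ⟨R A, (hR A).1⟩ = A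
    rw [(hR A).2, smul_smul, mul_inv_cancel₀ hε', one_smul, sub_sub_cancel]
  have hbij : Function.Bijective (L.domain.subtype - (ε : ℂ) • L.toFun) := by
    refine ⟨(injective_iff_map_eq_zero _).2 fun A hA => ?_, fun A => ⟨_, hsurj A⟩⟩
    have h1 : (A : E) - (ε : ℂ) • L A = 0 := hA
    refine Subtype.ext (hL A ?_)
    rw [sub_eq_zero.1 h1, smul_smul, inv_mul_cancel₀ hε', one_smul]
  refine ⟨hbij, fun A => ?_⟩
  have h : (LinearEquiv.ofBijective _ hbij).symm A = ⟨R A, (hR A).1⟩ := by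
    rw [LinearEquiv.symm_apply_eq]
    exact (hsurj A).symm
  rw [h, (hR A).2, hM]

/-- By injectivity the right inverse is also a left inverse, so `R (A - ε L A) = A`; solving for `R
(L A)` gives the claim. -/
theorem LinearPMap.apply_eq_of_right_inverse (hε : ε ≠ 0)
    (hM : ∀ A, M A = (ε : ℂ)⁻¹ • (R A - A))
    (hR : ∀ A, ∃ h : R A ∈ L.domain, L ⟨R A, h⟩ = (ε : ℂ)⁻¹ • (R A - A))
    (hL : ∀ A : L.domain, L A = (ε : ℂ)⁻¹ • (A : E) → (A : E) = 0) (A : L.domain) :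
    M A = R (L A) := by
  have hε' : (ε : ℂ) ≠ 0 := Complex.ofReal_ne_zero.2 hε
  obtain ⟨hdom, h⟩ := hR ((A : E) - (ε : ℂ) • L A)
  set D := (⟨R ((A : E) - (ε : ℂ) • L A), hdom⟩ : L.domain)
  have h0 : ((D - A : L.domain) : E) = 0 := by
    refine hL _ ?_
    rw [L.map_sub, h, AddSubgroupClass.coe_sub]
    have : L A = (ε : ℂ)⁻¹ • (ε : ℂ) • L A := by rw [smul_smul, inv_mul_cancel₀ hε', one_smul]
    nth_rewrite 3 [this]
    rw [← smul_sub]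
    congr 1
    abel
  have h1 : R ((A : E) - (ε : ℂ) • L A) = A := sub_eq_zero.1 h0
  rw [_root_.map_sub, _root_.map_smul, sub_eq_iff_eq_add'] at h1
  rw [hM, h1, add_sub_cancel_right, smul_smul, inv_mul_cancel₀ hε', one_smul]

end RightInverse

/-! ### The resolvent and the Yosida approximation. -/

section Resolvent

namespace QuantumDynamicalSemigroup

variable {H : Type*} [NormedAddCommGroup H] [InnerProductSpace ℂ H] [CompleteSpace H]
  {S : QuantumDynamicalSemigroup H}

theorem GeneratesAt.mem_domain {A B : H →L[ℂ] H} (h : S.GeneratesAt A B) :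
    A ∈ S.generator.domain := ⟨B, h⟩

theorem GeneratesAt.generator_eq {A B : H →L[ℂ] H} (h : S.GeneratesAt A B) :
    S.generator ⟨A, h.mem_domain⟩ = B :=
  (S.generator_spec _).unique h

theorem generatesAt_iff {A B : H →L[ℂ] H} :
    S.GeneratesAt A B ↔ ∀ x : lp (fun _ : ℕ => H) 2,
      Tendsto (fun h : ℝ≥0 => ((h : ℝ) : ℂ)⁻¹ * (predualFunctional x x (S.T h A)
        - predualFunctional x x A)) (𝓝[>] 0) (𝓝 (predualFunctional x x B)) := by
  rw [GeneratesAt, sigmaWeakTendsto_iff_diag]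
  simp only [← predualCLM_apply, _root_.map_smul, map_sub, smul_eq_mul]

/-- The resolvent `∫ e⁻ˢ T (ε s) ds` of a quantum Markov semigroup. -/
def IsMarkov.resolvent (hS : S.IsMarkov) (ε : ℝ) : (H →L[ℂ] H) →L[ℂ] (H →L[ℂ] H) :=
  hS.average (expLaw ε)

theorem IsMarkov.predualFunctional_resolvent (hS : S.IsMarkov) (ε : ℝ)
    (x y : lp (fun _ : ℕ => H) 2) (A : H →L[ℂ] H) :
    predualFunctional x y (hS.resolvent ε A)
      = ∫ t, predualFunctional x y (S.T t A) ∂expLaw ε :=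
  hS.predualFunctional_average _ x y A

theorem IsMarkov.predualFunctional_apply_resolvent (hS : S.IsMarkov) (ε : ℝ) (h : ℝ≥0)
    (x : lp (fun _ : ℕ => H) 2) (A : H →L[ℂ] H) :
    predualFunctional x x (S.T h (hS.resolvent ε A))
      = ∫ t, predualFunctional x x (S.T (h + t) A) ∂expLaw ε :=
  hS.predualFunctional_apply_average _ h x A

theorem IsMarkov.generatesAt_resolvent (hS : S.IsMarkov) {ε : ℝ} (hε : 0 < ε) (A : H →L[ℂ] H) :
    S.GeneratesAt (hS.resolvent ε A) ((ε : ℂ)⁻¹ • (hS.resolvent ε A - A)) := by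
  rw [generatesAt_iff]
  intro x
  have h := tendsto_integral_expLaw_add hε (S.continuous_predualFunctional x x A)
    fun t => hS.norm_predualFunctional_le t x x A
  simp only [← hS.predualFunctional_apply_resolvent, ← hS.predualFunctional_resolvent,
    S.map_zero] at h
  simpa only [← predualCLM_apply, _root_.map_smul, map_sub, smul_eq_mul] using h

/-- Since `T (t + r) = T t T r` and the functional composed with `T t` is again diagonal, the right
derivative at `t` reduces to the one at `0`. -/
theorem GeneratesAt.hasDerivWithinAt {A B : H →L[ℂ] H} (h : S.GeneratesAt A B)
    (x : lp (fun _ : ℕ => H) 2) {t : ℝ} (ht : 0 ≤ t) :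
    HasDerivWithinAt (fun s : ℝ => predualFunctional x x (S.T s.toNNReal A))
      (predualFunctional x x (S.T t.toNNReal B)) (Set.Ici t) t := by
  obtain ⟨z, hz⟩ := S.exists_predualFunctional t.toNNReal x
  rw [hasDerivWithinAt_Ici_iff_nnreal, hz B]
  have hz' := generatesAt_iff.1 h z
  refine hz'.congr fun r => ?_
  rw [Real.toNNReal_add ht r.coe_nonneg, Real.toNNReal_coe, S.map_add, hz, hz]

/-- The function `exp (-t/ε) ω (T t A)` is continuous with right derivative zero, hence constant,
and tends to `0` because `T t A` is bounded. So `ω A = 0` for every diagonal `ω`. -/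
theorem IsMarkov.eq_zero_of_generatesAt (hS : S.IsMarkov) {ε : ℝ} (hε : 0 < ε) {A : H →L[ℂ] H}
    (h : S.GeneratesAt A ((ε : ℂ)⁻¹ • A)) : A = 0 := by
  refine ext_predualFunctional fun x => ?_
  set F : ℝ → ℂ := fun s => predualFunctional x x (S.T s.toNNReal A) with hF
  have hFc : Continuous F := (S.continuous_predualFunctional x x A).comp continuous_real_toNNReal
  set G : ℝ → ℂ := fun s => Complex.exp (-(s / ε : ℝ)) * F s with hG
  have hGc : Continuous G := by fun_prop
  have hGd : ∀ t, 0 ≤ t → HasDerivWithinAt G 0 (Set.Ici t) t := by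
    intro t ht
    have h1 : HasDerivWithinAt F ((ε : ℂ)⁻¹ * F t) (Set.Ici t) t := by
      refine (h.hasDerivWithinAt x ht).congr_deriv ?_
      simp only [hF, ← predualCLM_apply, _root_.map_smul, smul_eq_mul]
    have h2 : HasDerivAt (fun s : ℝ => Complex.exp (-(s / ε : ℝ)))
        (Complex.exp (-(t / ε : ℝ)) * -((1 / ε : ℝ) : ℂ)) t :=
      ((hasDerivAt_id t).div_const ε).ofReal_comp.neg.cexp
    refine (h2.hasDerivWithinAt.mul h1).congr_deriv ?_
    push_cast
    ring
  have hGconst : ∀ t, 0 ≤ t → G t = F 0 := by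
    intro t ht
    have := constant_of_has_deriv_right_zero hGc.continuousOn
      (fun s hs => hGd s hs.1) t (Set.right_mem_Icc.2 ht)
    rw [this]
    simp [hG]
  have hlim : Tendsto G atTop (𝓝 0) := by
    have he : Tendsto (fun s : ℝ => Real.exp (-(s / ε)) * ((∑' n, ‖x n‖ * ‖x n‖) * (4 * ‖A‖)))
        atTop (𝓝 0) := by
      have := Real.tendsto_exp_neg_atTop_nhds_zero.comp (tendsto_id.atTop_div_const hε)
      simpa using this.mul_const ((∑' n, ‖x n‖ * ‖x n‖) * (4 * ‖A‖))
    refine squeeze_zero_norm (fun s => ?_) he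
    rw [norm_mul, ← Complex.ofReal_neg, Complex.norm_exp_ofReal]
    gcongr
    exact hS.norm_predualFunctional_le _ x x A
  have hF0 : F 0 = 0 := tendsto_nhds_unique
    (tendsto_const_nhds.congr' (by
      filter_upwards [eventually_ge_atTop 0] with t ht using (hGconst t ht).symm)) hlim
  simpa [hF, S.map_zero, ← predualCLM_apply] using hF0

/-- The Yosida approximation `ε⁻¹ (R - 1)` of the generator. -/
def IsMarkov.yosida (hS : S.IsMarkov) (ε : ℝ) : (H →L[ℂ] H) →L[ℂ] (H →L[ℂ] H) :=
  (ε : ℂ)⁻¹ • (hS.resolvent ε - 1)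

theorem IsMarkov.yosida_apply (hS : S.IsMarkov) (ε : ℝ) (A : H →L[ℂ] H) :
    hS.yosida ε A = (ε : ℂ)⁻¹ • (hS.resolvent ε A - A) := rfl

theorem IsMarkov.isResolventComposite_yosida (hS : S.IsMarkov) {ε : ℝ} (hε : 0 < ε) :
    IsResolventComposite S.generator ε (hS.yosida ε) :=
  isResolventComposite_of_right_inverse hε.ne' (hS.yosida_apply ε)
    (fun A => ⟨(hS.generatesAt_resolvent hε A).mem_domain,
      (hS.generatesAt_resolvent hε A).generator_eq⟩)
    fun A hA => hS.eq_zero_of_generatesAt hε (hA ▸ S.generator_spec A)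

theorem IsMarkov.yosida_apply_domain (hS : S.IsMarkov) {ε : ℝ} (hε : 0 < ε)
    (A : S.generator.domain) : hS.yosida ε A = hS.resolvent ε (S.generator A) :=
  LinearPMap.apply_eq_of_right_inverse hε.ne' (hS.yosida_apply ε)
    (fun A => ⟨(hS.generatesAt_resolvent hε A).mem_domain,
      (hS.generatesAt_resolvent hε A).generator_eq⟩)
    (fun A hA => hS.eq_zero_of_generatesAt hε (hA ▸ S.generator_spec A)) A

theorem IsMarkov.sigmaWeakTendsto_resolvent (hS : S.IsMarkov) (A : H →L[ℂ] H) :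
    SigmaWeakTendsto (fun ε => hS.resolvent ε A) (𝓝[>] 0) A := by
  refine sigmaWeakTendsto_iff.2 fun x y => ?_
  have h := tendsto_integral_expLaw (S.continuous_predualFunctional x y A)
    fun t => hS.norm_predualFunctional_le t x y A
  simpa only [← hS.predualFunctional_resolvent, S.map_zero] using h

theorem IsMarkov.sigmaWeakTendsto_yosida (hS : S.IsMarkov) (A : S.generator.domain) :
    SigmaWeakTendsto (fun ε => hS.yosida ε A) (𝓝[>] 0) (S.generator A) := by
  refine (hS.sigmaWeakTendsto_resolvent (S.generator A)).congr' ?_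
  filter_upwards [self_mem_nhdsWithin] with ε hε
  exact (hS.yosida_apply_domain hε A).symm

end QuantumDynamicalSemigroup

end Resolvent

/-! ### Exponentials of bounded operators. -/

section BanachAlgebra

variable {𝔸 : Type*} [NormedRing 𝔸] [NormedAlgebra ℂ 𝔸] [CompleteSpace 𝔸]

theorem NormedSpace.exp_add_smul (s t : ℂ) (x : 𝔸) :
    NormedSpace.exp ((s + t) • x) = NormedSpace.exp (s • x) * NormedSpace.exp (t • x) := by
  let := NormedAlgebra.restrictScalars ℚ ℂ 𝔸
  rw [add_smul, NormedSpace.exp_add_of_commute (((Commute.refl x).smul_left s).smul_right t)]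

/-- The scalar part is central and splits off. For `c ≥ 0` and `x` completely positive this exhibits
the left side as a positive multiple of a completely positive map, although `x - 1` need not be one.
-/
theorem NormedSpace.exp_smul_sub_one (c : ℂ) (x : 𝔸) :
    NormedSpace.exp (c • (x - 1)) = Complex.exp (-c) • NormedSpace.exp (c • x) := by
  let := NormedAlgebra.restrictScalars ℚ ℂ 𝔸
  have h : c • (x - 1) = algebraMap ℂ 𝔸 (-c) + c • x := by
    rw [smul_sub, Algebra.algebraMap_eq_smul_one, neg_smul]
    abel
  rw [h, NormedSpace.exp_add_of_commute (Algebra.commutes _ _), ← NormedSpace.algebraMap_exp_comm,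
    ← Complex.exp_eq_exp_ℂ, ← Algebra.smul_def]

end BanachAlgebra

namespace ContinuousLinearMap

variable {E : Type*} [NormedAddCommGroup E] [NormedSpace ℂ E] [CompleteSpace E] (M : E →L[ℂ] E)

theorem exp_apply_of_apply_eq_zero {M : E →L[ℂ] E} {v : E} (h : M v = 0) :
    NormedSpace.exp M v = v := by
  have h1 := (NormedSpace.exp_series_hasSum_exp' (𝕂 := ℂ) M).mapL
    (ContinuousLinearMap.apply ℂ E v)
  refine h1.unique ?_
  have h2 := hasSum_single
    (f := fun n => ContinuousLinearMap.apply ℂ E v ((n.factorial : ℂ)⁻¹ • M ^ n)) 0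
    fun n hn => by
      obtain ⟨k, rfl⟩ := Nat.exists_eq_succ_of_ne_zero hn
      simp [pow_succ, h]
  simpa using h2

theorem exp_zero_smul_apply (v : E) : NormedSpace.exp ((0 : ℂ) • M) v = v :=
  exp_apply_of_apply_eq_zero (by simp)

theorem exp_add_smul_apply (s t : ℂ) (v : E) : NormedSpace.exp ((s + t) • M) v
    = NormedSpace.exp (s • M) (NormedSpace.exp (t • M) v) :=
  DFunLike.congr_fun (NormedSpace.exp_add_smul s t M) v

theorem continuous_exp_nnreal_smul :
    Continuous fun t : ℝ≥0 => NormedSpace.exp (((t : ℝ) : ℂ) • M) :=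
  (differentiable_exp_smul_const ℂ M).continuous.comp
    (Complex.continuous_ofReal.comp NNReal.continuous_coe)

theorem tendsto_exp_nnreal_smul (v : E) :
    Tendsto (fun t : ℝ≥0 => ((t : ℝ) : ℂ)⁻¹ • (NormedSpace.exp (((t : ℝ) : ℂ) • M) v - v))
      (𝓝[>] 0) (𝓝 (M v)) := by
  have hd : HasDerivAt (fun u : ℂ => NormedSpace.exp (u • M)) M 0 := by
    simpa using hasDerivAt_exp_smul_const M (0 : ℂ)
  have hdv : HasDerivAt (fun u : ℂ => NormedSpace.exp (u • M) v) (M v) 0 :=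
    (ContinuousLinearMap.apply ℂ E v).hasFDerivAt.comp_hasDerivAt 0 hd
  have hslope := hasDerivAt_iff_tendsto_slope_zero.1 hdv
  have hm : Tendsto (fun t : ℝ≥0 => ((t : ℝ) : ℂ)) (𝓝[>] 0) (𝓝[≠] 0) := by
    refine tendsto_nhdsWithin_iff.2 ⟨?_, ?_⟩
    · have : Continuous fun t : ℝ≥0 => ((t : ℝ) : ℂ) := by fun_prop
      simpa using (this.tendsto 0).mono_left nhdsWithin_le_nhds
    · filter_upwards [self_mem_nhdsWithin] with t ht
      exact Complex.ofReal_ne_zero.2 (NNReal.coe_pos.2 ht).ne'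
  refine (hslope.comp hm).congr fun t => ?_
  rw [Function.comp_apply, zero_add, exp_zero_smul_apply]

end ContinuousLinearMap

/-! ### Closure properties of normal maps. -/

section Normal

variable {H : Type*} [NormedAddCommGroup H] [InnerProductSpace ℂ H]
  {φ ψ : (H →L[ℂ] H) →L[ℂ] (H →L[ℂ] H)}

theorem isNormalMap_iff_continuous : IsNormalMap φ ↔ ∀ x y : lp (fun _ : ℕ => H) 2,
    Continuous[sigmaWeak H, inferInstance] fun A => predualFunctional x y (φ A) := by
  let := sigmaWeak H
  exact continuous_sigmaWeak_iff

theorem isNormalMap_id : IsNormalMap (ContinuousLinearMap.id ℂ (H →L[ℂ] H)) :=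
  @continuous_id _ (sigmaWeak H)

theorem IsNormalMap.comp (hφ : IsNormalMap φ) (hψ : IsNormalMap ψ) : IsNormalMap (φ.comp ψ) :=
  @Continuous.comp _ _ _ (sigmaWeak H) (sigmaWeak H) (sigmaWeak H) ψ φ hφ hψ

theorem IsNormalMap.pow (hφ : IsNormalMap φ) (k : ℕ) : IsNormalMap (φ ^ k) := by
  induction k with
  | zero => exact isNormalMap_id
  | succ k ih => exact ih.comp hφ

theorem IsNormalMap.smul (hφ : IsNormalMap φ) (c : ℂ) : IsNormalMap (c • φ) := by
  let := sigmaWeak H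
  rw [isNormalMap_iff_continuous] at hφ ⊢
  intro x y
  simp only [smul_apply, predualFunctional_smul]
  exact continuous_const.mul (hφ x y)

theorem IsNormalMap.add (hφ : IsNormalMap φ) (hψ : IsNormalMap ψ) : IsNormalMap (φ + ψ) := by
  let := sigmaWeak H
  rw [isNormalMap_iff_continuous] at hφ hψ ⊢
  intro x y
  simp only [add_apply, predualFunctional_add]
  exact (hφ x y).add (hψ x y)

theorem isNormalMap_zero : IsNormalMap (0 : (H →L[ℂ] H) →L[ℂ] (H →L[ℂ] H)) := by
  let := sigmaWeak H
  exact continuous_const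

theorem IsNormalMap.sum {α : Type*} {φ : α → (H →L[ℂ] H) →L[ℂ] (H →L[ℂ] H)} {s : Finset α}
    (hφ : ∀ a ∈ s, IsNormalMap (φ a)) : IsNormalMap (∑ a ∈ s, φ a) :=
  Finset.sum_induction _ _ (fun _ _ => IsNormalMap.add) isNormalMap_zero hφ

variable [CompleteSpace H]

theorem IsCompletelyPositive.exp (hφ : IsCompletelyPositive φ) :
    IsCompletelyPositive (NormedSpace.exp φ) :=
  isCompletelyPositive_of_tendsto (fun _ => IsCompletelyPositive.sum fun k _ =>
    (hφ.pow k).smul (c := (k.factorial : ℂ)⁻¹) (by positivity))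
    (NormedSpace.exp_series_hasSum_exp' (𝕂 := ℂ) φ)

/-- Complete positivity enters because the passage of normality to norm limits uses positivity of
the limit. -/
theorem IsNormalMap.exp (hn : IsNormalMap φ) (hφ : IsCompletelyPositive φ) :
    IsNormalMap (NormedSpace.exp φ) :=
  isNormalMap_of_tendsto (fun _ => IsNormalMap.sum fun k _ => (hn.pow k).smul ((k.factorial : ℂ)⁻¹))
    (NormedSpace.exp_series_hasSum_exp' (𝕂 := ℂ) φ) fun _ => hφ.exp.map_nonneg

end Normal

/-! ### The semigroup generated by `c (R - 1)`. -/

namespace QuantumDynamicalSemigroup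

variable {H : Type*} [NormedAddCommGroup H] [InnerProductSpace ℂ H] [CompleteSpace H]

/-- The semigroup `exp (t c (R - 1))` generated by `c (R - 1)`, for `R` normal and completely
positive and `c ≥ 0`. -/
def expSemigroup (R : (H →L[ℂ] H) →L[ℂ] (H →L[ℂ] H)) (hn : IsNormalMap R)
    (hR : IsCompletelyPositive R) (c : ℝ≥0) : QuantumDynamicalSemigroup H :=
  have hexp : ∀ t : ℝ≥0, NormedSpace.exp (((t : ℝ) : ℂ) • ((c : ℝ) : ℂ) • (R - 1))
      = ((Real.exp (-(t * c)) : ℝ) : ℂ) • NormedSpace.exp (((t * c : ℝ) : ℂ) • R) := fun t => by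
    rw [smul_smul, ← Complex.ofReal_mul, NormedSpace.exp_smul_sub_one, Complex.ofReal_exp,
      Complex.ofReal_neg]
  have hcp : ∀ t : ℝ≥0, IsCompletelyPositive (((t * c : ℝ) : ℂ) • R) := fun t =>
    hR.smul (Complex.zero_le_real.2 (by positivity))
  { T := fun t => NormedSpace.exp (((t : ℝ) : ℂ) • ((c : ℝ) : ℂ) • (R - 1))
    normal := fun t => by
      rw [hexp]
      exact ((hn.smul _).exp (hcp t)).smul _
    completelyPositive := fun t => by
      rw [hexp]
      exact (hcp t).exp.smul (Complex.zero_le_real.2 (Real.exp_pos _).le)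
    map_zero := fun A => ContinuousLinearMap.exp_zero_smul_apply _ A
    map_add := fun t s A => by
      rw [NNReal.coe_add, Complex.ofReal_add]
      exact ContinuousLinearMap.exp_add_smul_apply _ _ _ A
    sigmaWeak_continuous := fun A => continuous_sigmaWeak_iff.2 fun x y =>
      (predualCLM x y).continuous.comp
        ((ContinuousLinearMap.continuous_exp_nnreal_smul _).clm_apply continuous_const) }

variable {R : (H →L[ℂ] H) →L[ℂ] (H →L[ℂ] H)} (hn : IsNormalMap R) (hR : IsCompletelyPositive R)
  (c : ℝ≥0)

theorem isMarkov_expSemigroup (h1 : R 1 = 1) : (expSemigroup R hn hR c).IsMarkov := fun t =>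
  ContinuousLinearMap.exp_apply_of_apply_eq_zero (by simp [h1])

theorem isUniformlyContinuous_expSemigroup : (expSemigroup R hn hR c).IsUniformlyContinuous :=
  ContinuousLinearMap.continuous_exp_nnreal_smul _

theorem generatesAt_expSemigroup (A : H →L[ℂ] H) :
    (expSemigroup R hn hR c).GeneratesAt A ((((c : ℝ) : ℂ) • (R - 1)) A) :=
  sigmaWeakTendsto_of_tendsto (ContinuousLinearMap.tendsto_exp_nnreal_smul _ A)

theorem generator_eq_toPMap {S : QuantumDynamicalSemigroup H}
    {M : (H →L[ℂ] H) →L[ℂ] (H →L[ℂ] H)} (h : ∀ A, S.GeneratesAt A (M A)) :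
    S.generator = (M : (H →L[ℂ] H) →ₗ[ℂ] (H →L[ℂ] H)).toPMap ⊤ := by
  refine LinearPMap.ext (Submodule.ext fun A => ⟨fun _ => trivial, fun _ => ⟨_, h A⟩⟩) ?_
  intro A h1 h2
  exact (S.generator_spec ⟨A, h1⟩).unique (h A)

end QuantumDynamicalSemigroup

theorem theorem3p1 {H : Type*} [NormedAddCommGroup H] [InnerProductSpace ℂ H] [CompleteSpace H]
    (S : QuantumDynamicalSemigroup H) (hS : S.IsMarkov) :
    ∃ Lε : ℝ → (H →L[ℂ] H) →L[ℂ] (H →L[ℂ] H),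
      (∀ ε > 0, IsResolventComposite S.generator ε (Lε ε)) ∧
      (∀ ε > 0, ∃ U : QuantumDynamicalSemigroup H, U.IsMarkov ∧ U.IsUniformlyContinuous ∧
        U.generator = (Lε ε : (H →L[ℂ] H) →ₗ[ℂ] (H →L[ℂ] H)).toPMap ⊤) ∧
      (∀ A : S.generator.domain,
        SigmaWeakTendsto (fun ε => Lε ε A) (𝓝[>] 0) (S.generator A)) ∧
      ∃ (φ : ℝ → (H →L[ℂ] H) →L[ℂ] (H →L[ℂ] H)) (G : ℝ → H →L[ℂ] H),
        (∀ ε > 0, IsNormalMap (φ ε) ∧ IsCompletelyPositive (φ ε)) ∧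
        (∀ ε > 0, ∀ A : H →L[ℂ] H, Lε ε A = φ ε A + G ε * A + A * star (G ε)) ∧
        (∀ A : S.generator.domain,
          SigmaWeakTendsto (fun ε => φ ε A + G ε * (A : H →L[ℂ] H) + (A : H →L[ℂ] H) * star (G ε))
            (𝓝[>] 0) (S.generator A)) := by
  have hn : ∀ ε, IsNormalMap (hS.resolvent ε) := fun ε => hS.isNormalMap_average _
  have hcp : ∀ ε, IsCompletelyPositive (hS.resolvent ε) := fun ε =>
    hS.isCompletelyPositive_average _
  -- The term `-ε⁻¹ A` is split evenly between left and right multiplication, whence the factor `2`.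
  -- The identity also holds at `ε = 0`, where all inverses are `0`, so it can be used without a
  -- restriction on `ε`.
  have hdecomp : ∀ (ε : ℝ) (A : H →L[ℂ] H), hS.yosida ε A = ((ε : ℂ)⁻¹ • hS.resolvent ε) A
      + (((-(2 * ε)⁻¹ : ℝ) : ℂ) • (1 : H →L[ℂ] H)) * A
      + A * star (((-(2 * ε)⁻¹ : ℝ) : ℂ) • (1 : H →L[ℂ] H)) := by
    intro ε A
    rw [star_smul, star_one, smul_one_mul, mul_smul_one, Complex.star_def, Complex.conj_ofReal,
      add_assoc, ← add_smul, hS.yosida_apply, smul_apply, smul_sub, sub_eq_add_neg, ← neg_smul]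
    congr 2
    push_cast
    ring
  refine ⟨hS.yosida, fun ε hε => hS.isResolventComposite_yosida hε, fun ε hε => ?_,
    hS.sigmaWeakTendsto_yosida, fun ε => (ε : ℂ)⁻¹ • hS.resolvent ε,
    fun ε => ((-(2 * ε)⁻¹ : ℝ) : ℂ) • 1, fun ε hε => ⟨(hn ε).smul _, (hcp ε).smul ?_⟩,
    fun ε _ => hdecomp ε, fun A => ?_⟩
  · refine ⟨.expSemigroup (hS.resolvent ε) (hn ε) (hcp ε) ε⁻¹.toNNReal,
      QuantumDynamicalSemigroup.isMarkov_expSemigroup _ _ _ (hS.average_one _),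
      QuantumDynamicalSemigroup.isUniformlyContinuous_expSemigroup _ _ _,
      QuantumDynamicalSemigroup.generator_eq_toPMap fun A => ?_⟩
    have h := QuantumDynamicalSemigroup.generatesAt_expSemigroup (hn ε) (hcp ε) ε⁻¹.toNNReal A
    have hc : ((ε⁻¹.toNNReal : ℝ) : ℂ) = (ε : ℂ)⁻¹ := by
      rw [Real.coe_toNNReal _ (inv_pos.2 hε).le, Complex.ofReal_inv]
    rwa [hc] at h
  · rw [← Complex.ofReal_inv]
    exact Complex.zero_le_real.2 (inv_pos.2 hε).le
  · exact (hS.sigmaWeakTendsto_yosida A).congr fun ε => hdecomp ε A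

end
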